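/- All graphs are finite and simple. An orientation $D$ of a graph $G$ replaces each edge by exactly one of the two possible arcs. A semi-proper orientation $(D,w)$ of $G$ is an orientation $D$ together with a positive integer weight $w(a)$ for every arc $a$ of $D$ such that adjacent vertices have distinct in-weights, where the in-weight of a vertex $v$ is the sum of the weights of the arcs towards $v$. The semi-proper orientation number $\overrightarrow{\chi}_s(G)$ is the minimum, over all semi-proper orientations $(D,w)$ of $G$, of the maximum in-weight of a vertex. A graph is outerplanar if it has a planar embedding in which all vertices lie on the boundary of the outer (unbounded) face. **Theorem.** For every outerplanar graph $G$ we have $\overrightarrow{\chi}_s(G)\le 4$, and this bound is tight: the universal outerplanar graph $\mathrm{UOP}(4)$ is outerplanar and $\overrightarrow{\chi}_s(\mathrm{UOP}(4))=4$. Here $\mathrm{UOP}(1)$ is a triangle, all of whose edges are called outeredges, and $\mathrm{UOP}(k+1)$ is obtained from $\mathrm{UOP}(k)$ by adding, for every outeredge $ab$ of $\mathrm{UOP}(k)$, a new vertex joined to $a$ and $b$; the outeredges of $\mathrm{UOP}(k+1)$ are the newly added edges. -/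

import Mathlib

namespace SimpleGraph

/-! ### Semi-proper orientations -/

/-- `D` is an orientation of `G`: every arc of `D` comes from an edge of `G`, and every edge of `G`
is replaced by exactly one of the two possible arcs. -/
def IsOrientation {V : Type*} (G : SimpleGraph V) (D : Digraph V) : Prop :=
  (∀ u v, D.Adj u v → G.Adj u v) ∧ (∀ u v, G.Adj u v → Xor (D.Adj u v) (D.Adj v u))

open Classical in
/-- The in-weight of `v`: the sum of the weights of the arcs of `D` towards `v`. -/
noncomputable def inWeight {V : Type*} [Fintype V] (D : Digraph V) (w : V → V → ℕ) (v : V) : ℕ :=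
  ∑ u : V with D.Adj u v, w u v

/-- A semi-proper orientation `(D, w)` of `G`. Only the values `weight u v` on arcs `u → v` of the
orientation are ever used. -/
structure SemiProperOrientation {V : Type*} [Fintype V] (G : SimpleGraph V) where
  /-- the orientation -/
  D : Digraph V
  isOrientation : G.IsOrientation D
  /-- the weight of the arc from the first to the second argument -/
  weight : V → V → ℕ
  weight_pos : ∀ u v, D.Adj u v → 0 < weight u v
  proper : ∀ u v, G.Adj u v → inWeight D weight u ≠ inWeight D weight v

/-- The maximum in-weight over all vertices (`0` if there are no vertices). -/
noncomputable def SemiProperOrientation.maxInWeight {V : Type*} [Fintype V] {G : SimpleGraph V}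
    (O : G.SemiProperOrientation) : ℕ :=
  Finset.univ.sup (inWeight O.D O.weight)

/-- The semi-proper orientation number: the minimum of the maximum in-weight over all semi-proper
orientations. The infimum is taken in `ℕ∞`, so that it is attained as soon as it is finite. -/
noncomputable def semiProperOrientationNumber {V : Type*} [Fintype V] (G : SimpleGraph V) : ℕ∞ :=
  ⨅ O : G.SemiProperOrientation, (O.maxInWeight : ℕ∞)

/-! ### Outerplanar graphs -/

/-- `A` is a simple arc (a homeomorphic image of the unit interval) with ends `p` and `q`. -/
def IsSimpleArc (A : Set (EuclideanSpace ℝ (Fin 2))) (p q : EuclideanSpace ℝ (Fin 2)) : Prop :=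
  ∃ γ : _root_.Path p q, Function.Injective γ ∧ Set.range γ = A

/-- A planar embedding of `G`: distinct vertices are distinct points of the plane, every edge is a
simple arc joining its ends and containing no other vertex, and two distinct edges meet
only in common ends. The values of `arc` outside the edge set are irrelevant. -/
structure PlanarEmbedding {V : Type*} (G : SimpleGraph V) where
  /-- the point representing a vertex -/
  pt : V → EuclideanSpace ℝ (Fin 2)
  pt_injective : Function.Injective pt
  /-- the arc representing an edge -/
  arc : Sym2 V → Set (EuclideanSpace ℝ (Fin 2))
  isSimpleArc : ∀ u v, G.Adj u v → IsSimpleArc (arc s(u, v)) (pt u) (pt v)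
  mem_of_pt_mem : ∀ e ∈ G.edgeSet, ∀ v, pt v ∈ arc e → v ∈ e
  arc_inter : ∀ e ∈ G.edgeSet, ∀ f ∈ G.edgeSet, e ≠ f →
    arc e ∩ arc f ⊆ pt '' {v | v ∈ e ∧ v ∈ f}

/-- The set of all points of the plane that lie on a vertex or on an edge. -/
def PlanarEmbedding.support {V : Type*} {G : SimpleGraph V} (P : G.PlanarEmbedding) :
    Set (EuclideanSpace ℝ (Fin 2)) :=
  Set.range P.pt ∪ ⋃ e ∈ G.edgeSet, P.arc e

/-- `F` is an outer face: an unbounded connected component of the complement of the drawing. -/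
def PlanarEmbedding.IsOuterFace {V : Type*} {G : SimpleGraph V} (P : G.PlanarEmbedding)
    (F : Set (EuclideanSpace ℝ (Fin 2))) : Prop :=
  (∃ x ∈ P.supportᶜ, F = connectedComponentIn P.supportᶜ x) ∧ ¬ Bornology.IsBounded F

/-- `G` is outerplanar: it has a planar embedding in which all vertices lie on the boundary of the
outer face. -/
def IsOuterplanar {V : Type*} (G : SimpleGraph V) : Prop :=
  ∃ (P : G.PlanarEmbedding) (F : Set (EuclideanSpace ℝ (Fin 2))),
    P.IsOuterFace F ∧ ∀ v, P.pt v ∈ frontier F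

/-! ### Universal outerplanar graphs -/

/-- A finite graph together with a set of distinguished edges, called its outeredges. -/
structure OuteredgeGraph where
  /-- the vertices -/
  V : Type
  [fintypeV : Fintype V]
  [decidableEqV : DecidableEq V]
  /-- the graph -/
  graph : SimpleGraph V
  /-- the outeredges -/
  outer : Finset (Sym2 V)

attribute [instance] OuteredgeGraph.fintypeV OuteredgeGraph.decidableEqV

/-- The triangle, all of whose edges are outeredges. -/
def OuteredgeGraph.triangle : OuteredgeGraph where
  V := Fin 3
  graph := ⊤
  outer := {s(0, 1), s(1, 2), s(0, 2)}

/-- Add an ear of length two to every outeredge `e`: one new vertex (`Sum.inr e`), joined to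
both ends of `e`. The outeredges of the new graph are the newly added edges. -/
def OuteredgeGraph.addEars (H : OuteredgeGraph) : OuteredgeGraph where
  V := H.V ⊕ {e : Sym2 H.V // e ∈ H.outer}
  graph :=
    { Adj := fun x y => match x, y with
        | Sum.inl u, Sum.inl v => H.graph.Adj u v
        | Sum.inl u, Sum.inr e => u ∈ e.1
        | Sum.inr e, Sum.inl u => u ∈ e.1
        | Sum.inr _, Sum.inr _ => False
      symm := ⟨by
        rintro (u | e) (v | f) h
        · exact H.graph.adj_symm h
        · exact h
        · exact h
        · exact h⟩
      loopless := ⟨by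
        rintro (u | e) h
        · exact H.graph.loopless.irrefl _ h
        · exact h⟩ }
  outer :=
    (Finset.univ.filter
      (fun p : H.V × {e : Sym2 H.V // e ∈ H.outer} => p.1 ∈ p.2.1)).image
        (fun p => s(Sum.inl p.1, Sum.inr p.2))

/-- The universal outerplanar graph `UOP(n)`, `n ≥ 1`, with its outeredges: `UOP(1)` is a triangle,
and `UOP(n + 1)` arises from `UOP(n)` by adding ears of length two to all outeredges.
(The value at `0` is irrelevant.) -/
def UOP : ℕ → OuteredgeGraph
  | 0 => OuteredgeGraph.triangle
  | 1 => OuteredgeGraph.triangle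
  | n + 2 => (UOP (n + 1)).addEars

end SimpleGraph

/-! ### Continuous arguments and theta graphs in the plane -/

namespace PlaneTopology

open Complex Set Topology

/-! Upper bound. In an outerplanar graph every nonempty vertex set `W` contains a vertex with at
most two neighbours in `W` (`IsOuterplanar.exists_le_two_neighbors`). Removing such vertices one at
a time and orienting edges towards the removed vertex gives an orientation with in-degrees at most 2
together with a proper 3-colouring `c`. Non-sources receive in-weight `2 + c v`, which is 2, 3 or 4
and is at least the in-degree; sources have in-weight 0, and two sources are never adjacent.

For the degeneracy, a subgraph of minimum degree 3 contains a subdivision of K₄, found on a longest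
path (`exists_crossing_chords`). The outer face is a connected set that avoids this subdivision and
adheres to its four branch vertices. This is excluded by `complete_four`, which reduces to `theta`:
a connected set avoiding three internally disjoint arcs from `a` to `b` cannot adhere to the
interiors of all three. Otherwise the continuous arguments of `(z - a) / (z - b)` on the complements
of the arcs could be merged, by taking medians, into one on the plane minus `{a, b}`, contradicting
the winding of a small circle around `a`.

Lower bound. If all in-weights in UOP(4) are at most 3, they form a proper colouring by 0, 1, 2, 3.
In any orientation, the in-degrees minus two sum to the number of edges minus twice the number of
vertices, which is -3. In-degrees are at most in-weights, and at most 2 at the last ears. Bounding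
the contribution of the ears over an outeredge by the two colours at its ends, from the last round
inwards, shows that this sum is at most -4.

Outerplanarity of UOP(4). The vertices are placed on a parabola and the edges drawn as chords; each
outeredge is a hull edge, so there is room for its ear. -/

theorem eqOn_of_exp_eq {X : Type*} [TopologicalSpace X] {S : Set X} (hS : IsPreconnected S)
    {f g : X → ℝ} (hf : ContinuousOn f S) (hg : ContinuousOn g S)
    (h : ∀ x ∈ S, exp (f x * I) = exp (g x * I)) {x₀ : X} (hx₀ : x₀ ∈ S) (h₀ : f x₀ = g x₀) :
    EqOn f g S := by
  have key : ∀ x ∈ S, ∃ n : ℤ, (f x - g x) / (2 * Real.pi) = n := by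
    intro x hx
    obtain ⟨n, hn⟩ := exp_eq_exp_iff_exists_int.1 (h x hx)
    refine ⟨n, ?_⟩
    have h1 : (f x : ℂ) = g x + n * (2 * Real.pi) :=
      mul_right_cancel₀ I_ne_zero (by rw [hn]; ring)
    have h2 : f x = g x + n * (2 * Real.pi) := by exact_mod_cast h1
    rw [h2]
    field_simp [Real.pi_ne_zero]
    ring
  have hcont : ContinuousOn (fun x => (f x - g x) / (2 * Real.pi)) S := (hf.sub hg).div_const _
  choose! n hn using key
  have hn' : ContinuousOn n S := by
    rw [Int.isClosedEmbedding_coe_real.isInducing.continuousOn_iff]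
    exact hcont.congr fun x hx => (hn x hx).symm
  intro x hx
  have h1 := hS.constant hn' hx hx₀
  have h2 : (f x - g x) / (2 * Real.pi) = (f x₀ - g x₀) / (2 * Real.pi) := by
    rw [hn x hx, hn x₀ hx₀, h1]
  rw [h₀, sub_self, zero_div, div_eq_zero_iff] at h2
  rcases h2 with h2 | h2
  · linarith
  · exact absurd h2 (by positivity)

/-- `h` is a continuous choice on `S` of an argument of `(z - a) / (z - b)`. -/
structure IsArgOn (a b : ℂ) (h : ℂ → ℝ) (S : Set ℂ) : Prop where
  continuousOn : ContinuousOn h S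
  eq : ∀ z ∈ S, (‖(z - a) / (z - b)‖ : ℂ) * exp (h z * I) = (z - a) / (z - b)

/-- For a path `γ` from `b` to `a` inside `A`, the map `(z - γ t) / (z - b)` is a nonvanishing
homotopy on the complement of `A` from the constant 1 to `(z - a) / (z - b)`. It lifts through
`exp`, and the imaginary part of the lift at time 1 is the argument. -/
theorem exists_isArgOn {A : Set ℂ} {a b : ℂ} (hA : JoinedIn A a b) :
    ∃ h, IsArgOn a b h Aᶜ := by
  obtain ⟨γ, hγ⟩ := hA.symm
  have hb : b ∈ A := by simpa using hγ 0
  have hne : ∀ (t : unitInterval) (z : (Aᶜ : Set ℂ)), (z - γ t) / ((z : ℂ) - b) ≠ 0 := by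
    intro t z
    refine div_ne_zero (sub_ne_zero.2 fun h => z.2 ?_) (sub_ne_zero.2 fun h => z.2 ?_)
    · rw [h]; exact hγ t
    · rw [h]; exact hb
  let H : C(unitInterval × (Aᶜ : Set ℂ), {z : ℂ // z ≠ 0}) :=
    ⟨fun p => ⟨(p.2 - γ p.1) / ((p.2 : ℂ) - b), hne p.1 p.2⟩, by
      refine Continuous.subtype_mk ?_ _
      refine Continuous.div (by fun_prop) (by fun_prop) fun p => ?_
      exact sub_ne_zero.2 fun h => p.2.2 (by rw [h]; exact hb)⟩
  let f₀ : C((Aᶜ : Set ℂ), ℂ) := ⟨fun _ => 0, continuous_const⟩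
  have H0 : ∀ z, H (0, z) = (⟨exp (f₀ z), exp_ne_zero _⟩ : {z : ℂ // z ≠ 0}) := by
    intro z
    ext
    have : (z : ℂ) - b ≠ 0 := sub_ne_zero.2 fun h => z.2 (by rw [h]; exact hb)
    simp [H, f₀, div_self this]
  let G := isCoveringMap_exp.liftHomotopy H f₀ H0
  have hG : ∀ z : (Aᶜ : Set ℂ), exp (G (1, z)) = (z - a) / ((z : ℂ) - b) := by
    intro z
    have := congrFun (isCoveringMap_exp.liftHomotopy_lifts H f₀ H0) (1, z)
    have := congrArg Subtype.val this
    simp only [Function.comp_apply] at this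
    rw [this]
    simp [H]
  classical
  refine ⟨fun z => if hz : z ∈ Aᶜ then (G (1, ⟨z, hz⟩)).im else 0, ?_, ?_⟩
  · rw [continuousOn_iff_continuous_domRestrict]
    have : Continuous fun z : (Aᶜ : Set ℂ) => (G (1, z)).im :=
      continuous_im.comp (G.continuous.comp (by fun_prop))
    convert this using 1
    ext z
    have hz : (z : ℂ) ∉ A := z.2
    simp [hz]
  · intro z hz
    rw [dif_pos hz, ← hG ⟨z, hz⟩, norm_exp, ofReal_exp, ← exp_add, re_add_im]

/-- On the circle of radius `‖a - b‖ / 2` around `a`, the quotient `(z - b) / (a - b)` stays within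
distance 1 of 1, so its principal argument is continuous. Adding it to `h` gives a continuous
argument of `(z - a) / (a - b)`, which must grow by 2π in one turn although the circle closes up. -/
theorem not_isArgOn_compl_pair {a b : ℂ} (hab : a ≠ b) (h : ℂ → ℝ) :
    ¬ IsArgOn a b h {a, b}ᶜ := by
  intro hh
  have hd : a - b ≠ 0 := sub_ne_zero.2 hab
  let z : ℝ → ℂ := fun t => a + ‖a - b‖ / 2 * exp (t * I)
  have hz : Continuous z := by fun_prop
  have hza : ∀ t, ‖z t - a‖ = ‖a - b‖ / 2 := by
    intro t
    simp [z, norm_exp_ofReal_mul_I]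
  have hpos : 0 < ‖a - b‖ := norm_pos_iff.2 hd
  have hza' : ∀ t, z t - a ≠ 0 := fun t => norm_pos_iff.1 (by rw [hza]; linarith)
  have hzb' : ∀ t, z t - b ≠ 0 := by
    intro t h0
    have : z t - a = -(a - b) := by linear_combination h0
    have h1 := hza t
    rw [this, norm_neg] at h1
    linarith
  have hmem : ∀ t, z t ∈ ({a, b}ᶜ : Set ℂ) := by
    intro t ht
    rcases ht with ht | ht
    · exact hza' t (sub_eq_zero.2 ht)
    · exact hzb' t (sub_eq_zero.2 ht)
  let s : ℝ → ℂ := fun t => (z t - b) / (a - b)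
  have hs : ∀ t, s t ∈ slitPlane := by
    intro t
    have : s t - 1 = (z t - a) / (a - b) := by
      simp only [s]; field_simp; ring
    have hlt : ‖s t - 1‖ < 1 := by
      rw [this, norm_div, hza]
      field_simp
      norm_num
    simpa using mem_slitPlane_of_norm_lt_one hlt
  let θ : ℝ → ℝ := fun t => h (z t) + arg (s t)
  have hscont : Continuous s := by fun_prop
  have hθ : Continuous θ := by
    refine Continuous.add ?_ ?_
    · exact hh.continuousOn.comp_continuous hz hmem
    · exact continuous_iff_continuousAt.2 fun t =>
        (continuousAt_arg (hs t)).comp hscont.continuousAt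
  have hexp : ∀ t, exp (θ t * I) = (‖a - b‖ / (a - b)) * exp (t * I) := by
    intro t
    have h1 := hh.eq (z t) (hmem t)
    have h2 := norm_mul_exp_arg_mul_I (s t)
    have h3 : (z t - a) / (z t - b) * s t = (z t - a) / (a - b) := by
      have := hzb' t
      simp only [s]; field_simp
    have h4 : ‖(z t - a) / (z t - b)‖ * ‖s t‖ = 1 / 2 := by
      rw [← norm_mul, h3, norm_div, hza]; field_simp
    have h5 : (‖(z t - a) / (z t - b)‖ : ℂ) * ‖s t‖ = 1 / 2 := by
      rw [← ofReal_mul, h4]; norm_num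
    have h6 : exp (θ t * I) = exp (h (z t) * I) * exp (arg (s t) * I) := by
      rw [← exp_add]; congr 1; simp only [θ]; push_cast; ring
    have h7 : (1 / 2 : ℂ) * exp (θ t * I) = (z t - a) / (a - b) := by
      rw [← h3, ← h1, ← h5, h6]
      nth_rewrite 3 [← h2]
      ring
    have h8 : z t - a = ‖a - b‖ / 2 * exp (t * I) := by simp [z]
    rw [h8] at h7
    linear_combination 2 * h7
  have key := eqOn_of_exp_eq (X := ℝ) isPreconnected_univ (f := θ) (g := fun t => t + θ 0)
    hθ.continuousOn (by fun_prop) (fun t _ => by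
      have h0 := hexp 0
      simp only [ofReal_zero, zero_mul, exp_zero, mul_one] at h0
      rw [hexp t, ← h0, ← exp_add]; congr 1; push_cast; ring) (mem_univ 0) (by simp)
  have h2π := key (mem_univ (2 * Real.pi))
  have hzz : z (2 * Real.pi) = z 0 := by
    simp [z, exp_two_pi_mul_I]
  have : θ (2 * Real.pi) = θ 0 := by simp only [θ, s, hzz]
  rw [this] at h2π
  have := Real.pi_pos
  simp only at h2π
  linarith

/-- The median of three real numbers. -/
def median (x y z : ℝ) : ℝ := max (min x y) (min (max x y) z)

theorem median_cases (x y z : ℝ) : median x y z = x ∨ median x y z = y ∨ median x y z = z := by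
  unfold median; grind

theorem median_eq₁₂ {x y z : ℝ} (h : x = y) : median x y z = x := by unfold median; grind
theorem median_eq₂₃ {x y z : ℝ} (h : y = z) : median x y z = y := by unfold median; grind
theorem median_eq₁₃ {x y z : ℝ} (h : x = z) : median x y z = x := by unfold median; grind

theorem IsArgOn.exp_eq {a b : ℂ} {f g : ℂ → ℝ} {S T : Set ℂ} (hf : IsArgOn a b f S)
    (hg : IsArgOn a b g T) {z : ℂ} (hS : z ∈ S) (hT : z ∈ T) (ha : z ≠ a) (hb : z ≠ b) :
    exp (f z * I) = exp (g z * I) := by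
  have h := (hf.eq z hS).trans (hg.eq z hT).symm
  refine mul_left_cancel₀ ?_ h
  rw [ofReal_ne_zero, norm_ne_zero_iff]
  exact div_ne_zero (sub_ne_zero.2 ha) (sub_ne_zero.2 hb)

theorem IsArgOn.eventuallyEq {a b : ℂ} {f g : ℂ → ℝ} {S T : Set ℂ} (hf : IsArgOn a b f S)
    (hg : IsArgOn a b g T) (hS : IsOpen S) (hT : IsOpen T) {z : ℂ} (hzS : z ∈ S) (hzT : z ∈ T)
    (ha : z ≠ a) (hb : z ≠ b) (hz : f z = g z) : f =ᶠ[𝓝 z] g := by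
  have hU : IsOpen (S ∩ T ∩ {a, b}ᶜ) :=
    (hS.inter hT).inter (Set.Finite.isClosed (by simp)).isOpen_compl
  obtain ⟨r, hr, hsub⟩ := Metric.isOpen_iff.1 hU z ⟨⟨hzS, hzT⟩, by simp [ha, hb]⟩
  have := eqOn_of_exp_eq (Metric.isPreconnected_ball (x := z) (r := r))
    (hf.continuousOn.mono fun x hx => (hsub hx).1.1)
    (hg.continuousOn.mono fun x hx => (hsub hx).1.2)
    (fun x hx => hf.exp_eq hg (hsub hx).1.1 (hsub hx).1.2
      (fun h => (hsub hx).2 (by simp [h])) (fun h => (hsub hx).2 (by simp [h])))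
    (Metric.mem_ball_self hr) hz
  exact Filter.eventuallyEq_of_mem (Metric.ball_mem_nhds z hr) this

/-- Normalisation at a base point: the shift is a multiple of 2π, and afterwards the first argument
agrees with `g` at `p`. -/
theorem IsArgOn.add_const {a b : ℂ} {f g : ℂ → ℝ} {S T : Set ℂ} (hf : IsArgOn a b f S)
    (hg : IsArgOn a b g T) {p : ℂ} (hpS : p ∈ S) (hpT : p ∈ T) (ha : p ≠ a) (hb : p ≠ b) :
    IsArgOn a b (fun z => f z + (g p - f p)) S := by
  refine ⟨hf.continuousOn.add continuousOn_const, fun z hz => ?_⟩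
  refine Eq.trans ?_ (hf.eq z hz)
  congr 1
  have h := hf.exp_eq hg hpS hpT ha hb
  push_cast
  rw [add_mul, exp_add, sub_mul, exp_sub, ← h, div_self (exp_ne_zero _), mul_one]

/-- If two arguments agree at a point of `F`, where `F` adheres to a connected set `E`, then they
agree on `E`. -/
theorem IsArgOn.eqOn_of_closure {a b : ℂ} {f g : ℂ → ℝ} {S T : Set ℂ} (hf : IsArgOn a b f S)
    (hg : IsArgOn a b g T) {F E : Set ℂ} (hF : IsPreconnected F) (hE : IsPreconnected E)
    (hFE : (closure F ∩ E).Nonempty) (hFS : F ∪ E ⊆ S) (hFT : F ∪ E ⊆ T)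
    (hFab : F ∪ E ⊆ {a, b}ᶜ) {p : ℂ} (hp : p ∈ F) (h : f p = g p) : EqOn f g E := by
  obtain ⟨q, hqF, hqE⟩ := hFE
  have h1 : IsPreconnected (insert q F) :=
    hF.subset_closure (subset_insert _ _) (insert_subset hqF subset_closure)
  have h2 : IsPreconnected (F ∪ E) := by
    have := h1.union q (mem_insert _ _) hqE hE
    rwa [insert_union, insert_eq_of_mem (mem_union_right F hqE)] at this
  refine (eqOn_of_exp_eq h2 (hf.continuousOn.mono hFS) (hg.continuousOn.mono hFT) (fun x hx => ?_)
    (mem_union_left E hp) h).mono subset_union_right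
  exact hf.exp_eq hg (hFS hx) (hFT hx) (fun h => hFab hx (by simp [h]))
    (fun h => hFab hx (by simp [h]))

/-- Normalise the arguments `h₁`, `h₂`, `h₃` on the complements of the three arcs to agree at a
point of `F`. Any two of them are continuous on `F` together with the interior of the remaining arc,
so they agree on that interior, and hence near each of its points. There the median equals their
common value, whatever the third function does; off all arcs it is a median of continuous functions.
Thus the median is a continuous argument away from `a` and `b`. -/
theorem theta_complex {a b : ℂ} (hab : a ≠ b) {A₁ A₂ A₃ F : Set ℂ}
    (c₁ : IsClosed A₁) (c₂ : IsClosed A₂) (c₃ : IsClosed A₃)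
    (j₁ : JoinedIn A₁ a b) (j₂ : JoinedIn A₂ a b) (j₃ : JoinedIn A₃ a b)
    (k₁ : IsPreconnected (A₁ \ {a, b})) (k₂ : IsPreconnected (A₂ \ {a, b}))
    (k₃ : IsPreconnected (A₃ \ {a, b}))
    (i₁₂ : A₁ ∩ A₂ ⊆ {a, b}) (i₂₃ : A₂ ∩ A₃ ⊆ {a, b}) (i₁₃ : A₁ ∩ A₃ ⊆ {a, b})
    (hF : IsPreconnected F) (d₁ : Disjoint F A₁) (d₂ : Disjoint F A₂) (d₃ : Disjoint F A₃)
    (f₁ : (closure F ∩ (A₁ \ {a, b})).Nonempty) (f₂ : (closure F ∩ (A₂ \ {a, b})).Nonempty)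
    (f₃ : (closure F ∩ (A₃ \ {a, b})).Nonempty) : False := by
  obtain ⟨p, hp⟩ : F.Nonempty := closure_nonempty_iff.1 (f₁.mono inter_subset_left)
  have ha₁ : a ∈ A₁ := j₁.source_mem
  have hb₁ : b ∈ A₁ := j₁.target_mem
  have hFab : F ⊆ {a, b}ᶜ := by
    intro x hx hx'
    rcases hx' with rfl | hx'
    · exact disjoint_left.1 d₁ hx ha₁
    · exact disjoint_left.1 d₁ hx (by rw [mem_singleton_iff.1 hx']; exact hb₁)
  have hpa : p ≠ a := fun h => hFab hp (by simp [h])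
  have hpb : p ≠ b := fun h => hFab hp (by simp [h])
  have s₁ : F ⊆ A₁ᶜ := d₁.subset_compl_right
  have s₂ : F ⊆ A₂ᶜ := d₂.subset_compl_right
  have s₃ : F ⊆ A₃ᶜ := d₃.subset_compl_right
  obtain ⟨h₁, H₁⟩ := exists_isArgOn j₁
  obtain ⟨g₂, G₂⟩ := exists_isArgOn j₂
  obtain ⟨g₃, G₃⟩ := exists_isArgOn j₃
  have H₂ := G₂.add_const H₁ (s₂ hp) (s₁ hp) hpa hpb
  have H₃ := G₃.add_const H₁ (s₃ hp) (s₁ hp) hpa hpb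
  set h₂ : ℂ → ℝ := fun z => g₂ z + (h₁ p - g₂ p)
  set h₃ : ℂ → ℝ := fun z => g₃ z + (h₁ p - g₃ p)
  have e₂ : h₁ p = h₂ p := by simp [h₂]
  have e₃ : h₁ p = h₃ p := by simp [h₃]
  have sub : ∀ {A B : Set ℂ}, F ⊆ Bᶜ → A ∩ B ⊆ {a, b} → F ∪ A \ {a, b} ⊆ Bᶜ := by
    intro A B hFB hAB
    refine union_subset hFB fun x hx hxB => hx.2 (hAB ⟨hx.1, hxB⟩)
  have sub' : ∀ A : Set ℂ, F ∪ A \ {a, b} ⊆ {a, b}ᶜ := fun A =>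
    union_subset hFab fun x hx => hx.2
  have E₁ : EqOn h₂ h₃ (A₁ \ {a, b}) := H₂.eqOn_of_closure H₃ hF k₁ f₁ (sub s₂ i₁₂) (sub s₃ i₁₃)
    (sub' _) hp (e₂.symm.trans e₃)
  have E₂ : EqOn h₁ h₃ (A₂ \ {a, b}) := H₁.eqOn_of_closure H₃ hF k₂ f₂
    (sub s₁ (by rwa [inter_comm])) (sub s₃ i₂₃) (sub' _) hp e₃
  have E₃ : EqOn h₁ h₂ (A₃ \ {a, b}) := H₁.eqOn_of_closure H₂ hF k₃ f₃
    (sub s₁ (by rwa [inter_comm])) (sub s₂ (by rwa [inter_comm])) (sub' _) hp e₂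
  have cont : ∀ {h : ℂ → ℝ} {A : Set ℂ}, IsArgOn a b h Aᶜ → IsClosed A → ∀ {z}, z ∉ A →
      ContinuousAt h z := fun H c z hz => H.continuousOn.continuousAt (c.isOpen_compl.mem_nhds hz)
  refine not_isArgOn_compl_pair hab (fun z => median (h₁ z) (h₂ z) (h₃ z)) ⟨?_, ?_⟩
  · intro z hz
    apply ContinuousAt.continuousWithinAt
    have hza : z ≠ a := fun h => hz (by simp [h])
    have hzb : z ≠ b := fun h => hz (by simp [h])
    by_cases z₁ : z ∈ A₁
    · have n₂ : z ∉ A₂ := fun h => hz (i₁₂ ⟨z₁, h⟩)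
      have n₃ : z ∉ A₃ := fun h => hz (i₁₃ ⟨z₁, h⟩)
      have ev := H₂.eventuallyEq H₃ c₂.isOpen_compl c₃.isOpen_compl n₂ n₃ hza hzb (E₁ ⟨z₁, hz⟩)
      exact (cont H₂ c₂ n₂).congr (ev.mono fun x hx => (median_eq₂₃ hx).symm)
    by_cases z₂ : z ∈ A₂
    · have n₃ : z ∉ A₃ := fun h => hz (i₂₃ ⟨z₂, h⟩)
      have ev := H₁.eventuallyEq H₃ c₁.isOpen_compl c₃.isOpen_compl z₁ n₃ hza hzb (E₂ ⟨z₂, hz⟩)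
      exact (cont H₁ c₁ z₁).congr (ev.mono fun x hx => (median_eq₁₃ hx).symm)
    by_cases z₃ : z ∈ A₃
    · have ev := H₁.eventuallyEq H₂ c₁.isOpen_compl c₂.isOpen_compl z₁ z₂ hza hzb (E₃ ⟨z₃, hz⟩)
      exact (cont H₁ c₁ z₁).congr (ev.mono fun x hx => (median_eq₁₂ hx).symm)
    have C₁ := cont H₁ c₁ z₁
    have C₂ := cont H₂ c₂ z₂
    have C₃ := cont H₃ c₃ z₃
    exact (C₁.min C₂).max ((C₁.max C₂).min C₃)
  · intro z hz
    by_cases z₁ : z ∈ A₁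
    · have n₂ : z ∉ A₂ := fun h => hz (i₁₂ ⟨z₁, h⟩)
      rw [median_eq₂₃ (E₁ ⟨z₁, hz⟩)]
      exact H₂.eq z n₂
    by_cases z₂ : z ∈ A₂
    · rw [median_eq₁₃ (E₂ ⟨z₂, hz⟩)]
      exact H₁.eq z z₁
    by_cases z₃ : z ∈ A₃
    · rw [median_eq₁₂ (E₃ ⟨z₃, hz⟩)]
      exact H₁.eq z z₁
    rcases median_cases (h₁ z) (h₂ z) (h₃ z) with h | h | h <;> rw [h]
    · exact H₁.eq z z₁
    · exact H₂.eq z z₂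
    · exact H₃.eq z z₃

end PlaneTopology

/-! ### Arc-like sets, theta graphs and subdivisions of K₄ -/

namespace PlaneTopology

open Set Topology

/-- A closed set which behaves like an arc with ends `u` and `v`: it contains a path from `u` to
`v` and it stays connected when ends are deleted. -/
structure IsArcLike {X : Type*} [TopologicalSpace X] (S : Set X) (u v : X) : Prop where
  isClosed : IsClosed S
  joinedIn : JoinedIn S u v
  ne : u ≠ v
  isPreconnected : IsPreconnected S
  diff_left : IsPreconnected (S \ {u})
  diff_right : IsPreconnected (S \ {v})
  diff_pair : IsPreconnected (S \ {u, v})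
  nonempty : (S \ {u, v}).Nonempty

namespace IsArcLike

variable {X : Type*} [TopologicalSpace X] {S T : Set X} {u v w : X}

theorem left_mem (h : IsArcLike S u v) : u ∈ S := h.joinedIn.source_mem

theorem right_mem (h : IsArcLike S u v) : v ∈ S := h.joinedIn.target_mem

theorem symm (h : IsArcLike S u v) : IsArcLike S v u where
  isClosed := h.isClosed
  joinedIn := h.joinedIn.symm
  ne := h.ne.symm
  isPreconnected := h.isPreconnected
  diff_left := h.diff_right
  diff_right := h.diff_left
  diff_pair := by rw [pair_comm]; exact h.diff_pair
  nonempty := by rw [pair_comm]; exact h.nonempty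

/-- Connectedness after deleting a single end makes the notion stable under concatenation: without
`u` and `w`, the union is `S \ {u} ∪ T \ {w}`, two connected sets sharing `v`. -/
theorem trans (h : IsArcLike S u v) (h' : IsArcLike T v w) (hST : S ∩ T ⊆ {v}) :
    IsArcLike (S ∪ T) u w := by
  have huT : u ∉ T := fun hu => h.ne (hST ⟨h.left_mem, hu⟩)
  have hwS : w ∉ S := fun hw => h'.ne (hST ⟨hw, h'.right_mem⟩).symm
  have e₁ : (S ∪ T) \ {u} = S \ {u} ∪ T := by
    rw [union_sdiff_distrib, sdiff_singleton_eq_self huT]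
  have e₂ : (S ∪ T) \ {w} = S ∪ T \ {w} := by
    rw [union_sdiff_distrib, sdiff_singleton_eq_self hwS]
  have e₃ : (S ∪ T) \ {u, w} = S \ {u} ∪ T \ {w} := by
    ext x
    simp only [mem_sdiff, mem_union, mem_insert_iff, mem_singleton_iff]
    grind
  have m₁ : v ∈ S \ {u} := ⟨h.right_mem, h.ne.symm⟩
  have m₂ : v ∈ T \ {w} := ⟨h'.left_mem, h'.ne⟩
  refine ⟨h.isClosed.union h'.isClosed,
    (h.joinedIn.mono subset_union_left).trans (h'.joinedIn.mono subset_union_right),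
    fun e => huT (e ▸ h'.right_mem), h.isPreconnected.union v m₁.1 m₂.1 h'.isPreconnected, ?_, ?_,
    ?_, ?_⟩
  · rw [e₁]; exact h.diff_left.union v m₁ m₂.1 h'.isPreconnected
  · rw [e₂]; exact h.isPreconnected.union v m₁.1 m₂ h'.diff_right
  · rw [e₃]; exact h.diff_left.union v m₁ m₂ h'.diff_right
  · rw [e₃]; exact ⟨v, Or.inl m₁⟩

theorem of_path [T2Space X] (γ : Path u v) (hγ : Function.Injective γ) :
    IsArcLike (range γ) u v := by
  have hd : ∀ s : Set unitInterval, range γ \ γ '' s = γ '' sᶜ := fun s => by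
    rw [← image_univ, ← image_sdiff hγ, compl_eq_univ_sdiff]
  have h0 : ({u} : Set X) = γ '' {0} := by simp
  have h1 : ({v} : Set X) = γ '' {1} := by simp
  have h01 : ({u, v} : Set X) = γ '' {0, 1} := by simp [image_pair]
  have hc : ∀ s : Set unitInterval, OrdConnected s → IsPreconnected (γ '' s) := fun s hs =>
    hs.isPreconnected.image _ γ.continuous.continuousOn
  have c0 : ({0}ᶜ : Set unitInterval) = Ioi 0 := by
    ext x; simp [pos_iff_ne_zero]
  have c1 : ({1}ᶜ : Set unitInterval) = Iio 1 := by
    ext x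
    exact ⟨fun h => lt_of_le_of_ne (show x ≤ 1 from x.2.2) h, fun h => ne_of_lt h⟩
  have c01 : ({0, 1}ᶜ : Set unitInterval) = Ioo 0 1 := by
    have : ({0, 1}ᶜ : Set unitInterval) = {0}ᶜ ∩ {1}ᶜ := by
      rw [← compl_union]; rfl
    rw [this, c0, c1]; rfl
  refine ⟨(isCompact_range γ.continuous).isClosed, ⟨γ, fun t => mem_range_self t⟩, ?_,
    isPreconnected_range γ.continuous, ?_, ?_, ?_, ?_⟩
  · intro h
    have : (0 : unitInterval) = 1 := hγ (by simp [h])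
    exact zero_ne_one this
  · rw [h0, hd, c0]; exact hc _ ordConnected_Ioi
  · rw [h1, hd, c1]; exact hc _ ordConnected_Iio
  · rw [h01, hd, c01]; exact hc _ ordConnected_Ioo
  · rw [h01, hd, c01]
    exact (nonempty_Ioo.2 zero_lt_one).image _

end IsArcLike

/-- A connected set which avoids a theta graph in the plane cannot adhere to the interiors of all
three arcs. -/
theorem theta {a b : EuclideanSpace ℝ (Fin 2)} {A₁ A₂ A₃ F : Set (EuclideanSpace ℝ (Fin 2))}
    (h₁ : IsArcLike A₁ a b) (h₂ : IsArcLike A₂ a b) (h₃ : IsArcLike A₃ a b)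
    (i₁₂ : A₁ ∩ A₂ ⊆ {a, b}) (i₂₃ : A₂ ∩ A₃ ⊆ {a, b}) (i₁₃ : A₁ ∩ A₃ ⊆ {a, b})
    (hF : IsPreconnected F) (d₁ : Disjoint F A₁) (d₂ : Disjoint F A₂) (d₃ : Disjoint F A₃)
    (f₁ : (closure F ∩ (A₁ \ {a, b})).Nonempty) (f₂ : (closure F ∩ (A₂ \ {a, b})).Nonempty)
    (f₃ : (closure F ∩ (A₃ \ {a, b})).Nonempty) : False := by
  let e : EuclideanSpace ℝ (Fin 2) ≃ₜ ℂ := Complex.orthonormalBasisOneI.repr.symm.toHomeomorph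
  have hd : ∀ A : Set (EuclideanSpace ℝ (Fin 2)), e '' A \ {e a, e b} = e '' (A \ {a, b}) := by
    intro A
    rw [image_sdiff e.injective, image_pair]
  have hi : ∀ {A B : Set (EuclideanSpace ℝ (Fin 2))}, A ∩ B ⊆ {a, b} →
      e '' A ∩ e '' B ⊆ {e a, e b} := by
    intro A B h
    rw [← image_inter e.injective, ← image_pair]
    exact image_mono h
  have hj : ∀ {A : Set (EuclideanSpace ℝ (Fin 2))}, JoinedIn A a b →
      JoinedIn (e '' A) (e a) (e b) := fun h => h.map e.continuous
  have hp : ∀ {A : Set (EuclideanSpace ℝ (Fin 2))}, IsPreconnected A → IsPreconnected (e '' A) :=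
    fun h => h.image _ e.continuous.continuousOn
  have hf : ∀ {A : Set (EuclideanSpace ℝ (Fin 2))}, (closure F ∩ (A \ {a, b})).Nonempty →
      (closure (e '' F) ∩ (e '' A \ {e a, e b})).Nonempty := by
    intro A h
    rw [hd, ← e.image_closure, ← image_inter e.injective]
    exact h.image _
  refine theta_complex (e.injective.ne h₁.ne) (e.isClosedMap _ h₁.isClosed)
    (e.isClosedMap _ h₂.isClosed) (e.isClosedMap _ h₃.isClosed) (hj h₁.joinedIn) (hj h₂.joinedIn)
    (hj h₃.joinedIn) ?_ ?_ ?_ (hi i₁₂) (hi i₂₃) (hi i₁₃) (hp hF)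
    ((disjoint_image_iff e.injective).2 d₁) ((disjoint_image_iff e.injective).2 d₂)
    ((disjoint_image_iff e.injective).2 d₃) (hf f₁) (hf f₂) (hf f₃)
  · rw [hd]; exact hp h₁.diff_pair
  · rw [hd]; exact hp h₂.diff_pair
  · rw [hd]; exact hp h₃.diff_pair

/-- The theta graph consists of `P₀₁` and the detours from `x₀` to `x₁` through `x₂` and through
`x₃`; the points `x₂` and `x₃` are interior to the detours. -/
theorem theta_of_complete_four {x₀ x₁ x₂ x₃ : EuclideanSpace ℝ (Fin 2)}
    {P₀₁ P₀₂ P₀₃ P₁₂ P₁₃ F : Set (EuclideanSpace ℝ (Fin 2))}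
    (h₀₁ : IsArcLike P₀₁ x₀ x₁) (h₀₂ : IsArcLike P₀₂ x₀ x₂) (h₀₃ : IsArcLike P₀₃ x₀ x₃)
    (h₁₂ : IsArcLike P₁₂ x₁ x₂) (h₁₃ : IsArcLike P₁₃ x₁ x₃)
    (a₁ : P₀₁ ∩ P₀₂ ⊆ {x₀}) (a₂ : P₀₁ ∩ P₀₃ ⊆ {x₀}) (a₃ : P₀₁ ∩ P₁₂ ⊆ {x₁})
    (a₄ : P₀₁ ∩ P₁₃ ⊆ {x₁}) (a₅ : P₀₂ ∩ P₀₃ ⊆ {x₀}) (a₆ : P₀₂ ∩ P₁₂ ⊆ {x₂})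
    (a₇ : P₀₂ ∩ P₁₃ ⊆ ∅) (a₈ : P₀₃ ∩ P₁₂ ⊆ ∅) (a₉ : P₀₃ ∩ P₁₃ ⊆ {x₃}) (a₁₀ : P₁₂ ∩ P₁₃ ⊆ {x₁})
    (hF : IsPreconnected F) (d₀₁ : Disjoint F P₀₁) (d₀₂ : Disjoint F P₀₂) (d₀₃ : Disjoint F P₀₃)
    (d₁₂ : Disjoint F P₁₂) (d₁₃ : Disjoint F P₁₃) (f₂ : x₂ ∈ closure F) (f₃ : x₃ ∈ closure F)
    (f₀₁ : (closure F ∩ (P₀₁ \ {x₀, x₁})).Nonempty) : False := by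
  refine theta h₀₁ (h₀₂.trans h₁₂.symm a₆) (h₀₃.trans h₁₃.symm a₉) ?_ ?_ ?_ hF d₀₁
    (disjoint_union_right.2 ⟨d₀₂, d₁₂⟩) (disjoint_union_right.2 ⟨d₀₃, d₁₃⟩) f₀₁
    ⟨x₂, f₂, Or.inl h₀₂.right_mem, ?_⟩ ⟨x₃, f₃, Or.inl h₀₃.right_mem, ?_⟩
  · rintro z ⟨h, h' | h'⟩
    · exact Or.inl (a₁ ⟨h, h'⟩)
    · exact Or.inr (a₃ ⟨h, h'⟩)
  · rintro z ⟨h | h, h' | h'⟩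
    · exact Or.inl (a₅ ⟨h, h'⟩)
    · exact (a₇ ⟨h, h'⟩).elim
    · exact (a₈ ⟨h', h⟩).elim
    · exact Or.inr (a₁₀ ⟨h, h'⟩)
  · rintro z ⟨h, h' | h'⟩
    · exact Or.inl (a₂ ⟨h, h'⟩)
    · exact Or.inr (a₄ ⟨h, h'⟩)
  · simp [h₀₂.ne.symm, h₁₂.ne.symm]
  · simp [h₀₃.ne.symm, h₁₃.ne.symm]

/-- Otherwise the component is relatively open and closed in the complement of the finite set `X`.
That complement is connected in the plane, so the component would contain `K \ X`. -/
theorem exists_mem_closure_component {K X : Set (EuclideanSpace ℝ (Fin 2))} (hK : IsClosed K)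
    (hX : X.Finite) (hKX : (K \ X).Nonempty) {p : EuclideanSpace ℝ (Fin 2)}
    (hp : p ∈ Kᶜ) (hpX : p ∉ X) : ∃ z ∈ closure (connectedComponentIn Kᶜ p), z ∈ K \ X := by
  by_contra! h
  set C := connectedComponentIn Kᶜ p with hC
  have hCo : IsOpen C := hK.isOpen_compl.connectedComponentIn
  have hcl : ∀ z ∈ closure C, z ∉ K → z ∈ C := by
    intro z hz hzK
    have ho : IsOpen (connectedComponentIn Kᶜ z) := hK.isOpen_compl.connectedComponentIn
    obtain ⟨y, hy, hyC⟩ := mem_closure_iff.1 hz _ ho (mem_connectedComponentIn hzK)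
    rw [hC, connectedComponentIn_eq hyC, ← connectedComponentIn_eq hy]
    exact mem_connectedComponentIn hzK
  have hconn : IsPreconnected Xᶜ :=
    (hX.countable.isConnected_compl_of_one_lt_rank (by
      rw [← Module.finrank_eq_rank]; simp)).isPreconnected
  have hsub : Xᶜ ⊆ C := by
    refine hconn.subset_left_of_subset_union hCo isClosed_closure.isOpen_compl
      (disjoint_compl_right.mono_left subset_closure) (fun z hz => ?_)
      ⟨p, hpX, mem_connectedComponentIn hp⟩
    by_cases hzC : z ∈ closure C
    · left
      by_contra hn
      exact h z hzC ⟨by_contra fun hzK => hn (hcl z hzC hzK), hz⟩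
    · exact Or.inr hzC
  obtain ⟨z, hzK, hzX⟩ := hKX
  exact connectedComponentIn_subset _ _ (hsub hzX) hzK

/-- A connected set which avoids a subdivision of `K₄` in the plane cannot adhere to all four
branch vertices. -/
theorem complete_four {x₀ x₁ x₂ x₃ : EuclideanSpace ℝ (Fin 2)}
    {P₀₁ P₀₂ P₀₃ P₁₂ P₁₃ P₂₃ F : Set (EuclideanSpace ℝ (Fin 2))}
    (h₀₁ : IsArcLike P₀₁ x₀ x₁) (h₀₂ : IsArcLike P₀₂ x₀ x₂) (h₀₃ : IsArcLike P₀₃ x₀ x₃)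
    (h₁₂ : IsArcLike P₁₂ x₁ x₂) (h₁₃ : IsArcLike P₁₃ x₁ x₃) (h₂₃ : IsArcLike P₂₃ x₂ x₃)
    (a₁ : P₀₁ ∩ P₀₂ ⊆ {x₀}) (a₂ : P₀₁ ∩ P₀₃ ⊆ {x₀}) (a₃ : P₀₁ ∩ P₁₂ ⊆ {x₁})
    (a₄ : P₀₁ ∩ P₁₃ ⊆ {x₁}) (a₅ : P₀₂ ∩ P₀₃ ⊆ {x₀}) (a₆ : P₀₂ ∩ P₁₂ ⊆ {x₂})
    (a₇ : P₀₂ ∩ P₁₃ ⊆ ∅) (a₈ : P₀₃ ∩ P₁₂ ⊆ ∅) (a₉ : P₀₃ ∩ P₁₃ ⊆ {x₃}) (a₁₀ : P₁₂ ∩ P₁₃ ⊆ {x₁})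
    (a₁₁ : P₀₁ ∩ P₂₃ ⊆ ∅) (a₁₂ : P₀₂ ∩ P₂₃ ⊆ {x₂}) (a₁₃ : P₀₃ ∩ P₂₃ ⊆ {x₃})
    (a₁₄ : P₁₂ ∩ P₂₃ ⊆ {x₂}) (a₁₅ : P₁₃ ∩ P₂₃ ⊆ {x₃})
    (hF : IsPreconnected F) (d₀₁ : Disjoint F P₀₁) (d₀₂ : Disjoint F P₀₂) (d₀₃ : Disjoint F P₀₃)
    (d₁₂ : Disjoint F P₁₂) (d₁₃ : Disjoint F P₁₃) (d₂₃ : Disjoint F P₂₃)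
    (f₀ : x₀ ∈ closure F) (f₁ : x₁ ∈ closure F) (f₂ : x₂ ∈ closure F) (f₃ : x₃ ∈ closure F) :
    False := by
  obtain ⟨p, hp⟩ : F.Nonempty := closure_nonempty_iff.1 ⟨_, f₀⟩
  set K := P₀₁ ∪ P₀₂ ∪ P₀₃ ∪ P₁₂ ∪ P₁₃ ∪ P₂₃ with hKdef
  have hK : IsClosed K := ((((h₀₁.isClosed.union h₀₂.isClosed).union h₀₃.isClosed).union
    h₁₂.isClosed).union h₁₃.isClosed).union h₂₃.isClosed
  have hFK : F ⊆ Kᶜ := by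
    refine Disjoint.subset_compl_right ?_
    simp only [hKdef, disjoint_union_right]
    exact ⟨⟨⟨⟨⟨d₀₁, d₀₂⟩, d₀₃⟩, d₁₂⟩, d₁₃⟩, d₂₃⟩
  have m₀ : x₀ ∈ P₀₁ := h₀₁.left_mem
  have m₁ : x₁ ∈ P₀₁ := h₀₁.right_mem
  have m₂ : x₂ ∈ P₂₃ := h₂₃.left_mem
  have m₃ : x₃ ∈ P₂₃ := h₂₃.right_mem
  have hpX : p ∉ ({x₀, x₁, x₂, x₃} : Set (EuclideanSpace ℝ (Fin 2))) := by
    rintro (h | h | h | h)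
    · exact disjoint_left.1 d₀₁ hp (h ▸ m₀)
    · exact disjoint_left.1 d₀₁ hp (h ▸ m₁)
    · exact disjoint_left.1 d₂₃ hp (h ▸ m₂)
    · exact disjoint_left.1 d₂₃ hp (h ▸ m₃)
  have hKX : (K \ {x₀, x₁, x₂, x₃}).Nonempty := by
    obtain ⟨z, hz, hz'⟩ := h₀₁.nonempty
    refine ⟨z, by simp [hKdef, hz], ?_⟩
    rintro (h | h | h | h)
    · exact hz' (Or.inl h)
    · exact hz' (Or.inr h)
    · exact a₁₁ ⟨hz, h ▸ m₂⟩
    · exact a₁₁ ⟨hz, h ▸ m₃⟩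
  -- Enlarging `F` to a component of the complement of `K` provides a boundary point that is not a
  -- branch vertex. It is interior to one of the six arcs, and the six cases below are relabellings
  -- of `theta_of_complete_four`.
  obtain ⟨z, hzC, hzK, hzX⟩ :=
    exists_mem_closure_component hK (Set.toFinite _) hKX (hFK hp) hpX
  set C := connectedComponentIn Kᶜ p
  have hC : IsPreconnected C := isPreconnected_connectedComponentIn
  have hCK : Disjoint C K := disjoint_left.2 fun x hx => connectedComponentIn_subset _ _ hx
  simp only [hKdef, disjoint_union_right] at hCK
  obtain ⟨⟨⟨⟨⟨e₀₁, e₀₂⟩, e₀₃⟩, e₁₂⟩, e₁₃⟩, e₂₃⟩ := hCK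
  have hcl : closure F ⊆ closure C := closure_mono (hF.subset_connectedComponentIn hp hFK)
  have g₀ := hcl f₀
  have g₁ := hcl f₁
  have g₂ := hcl f₂
  have g₃ := hcl f₃
  have sub : ∀ {A B D : Set (EuclideanSpace ℝ (Fin 2))}, A ∩ B ⊆ D → B ∩ A ⊆ D := fun h => by
    rwa [inter_comm]
  simp only [mem_insert_iff, mem_singleton_iff, not_or] at hzX
  obtain ⟨z₀, z₁, z₂, z₃⟩ := hzX
  rcases hzK with ((((h | h) | h) | h) | h) | h
  · exact theta_of_complete_four h₀₁ h₀₂ h₀₃ h₁₂ h₁₃ a₁ a₂ a₃ a₄ a₅ a₆ a₇ a₈ a₉ a₁₀ hC e₀₁ e₀₂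
      e₀₃ e₁₂ e₁₃ g₂ g₃ ⟨z, hzC, h, by simp [z₀, z₁]⟩
  · exact theta_of_complete_four h₀₂ h₀₁ h₀₃ h₁₂.symm h₂₃ (sub a₁) a₅ a₆ a₁₂ a₂ a₃ a₁₁ a₈ a₁₃ a₁₄
      hC e₀₂ e₀₁ e₀₃ e₁₂ e₂₃ g₁ g₃ ⟨z, hzC, h, by simp [z₀, z₂]⟩
  · exact theta_of_complete_four h₀₃ h₀₁ h₀₂ h₁₃.symm h₂₃.symm (sub a₂) (sub a₅) a₉ a₁₃ a₁ a₄ a₁₁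
      a₇ a₁₂ a₁₅ hC e₀₃ e₀₁ e₀₂ e₁₃ e₂₃ g₁ g₂ ⟨z, hzC, h, by simp [z₀, z₃]⟩
  · exact theta_of_complete_four h₁₂ h₀₁.symm h₁₃ h₀₂.symm h₂₃ (sub a₃) a₁₀ (sub a₆) a₁₄ a₄ a₁ a₁₁
      (sub a₇) a₁₅ a₁₂ hC e₁₂ e₀₁ e₁₃ e₀₂ e₂₃ g₀ g₃ ⟨z, hzC, h, by simp [z₁, z₂]⟩
  · exact theta_of_complete_four h₁₃ h₀₁.symm h₁₂ h₀₃.symm h₂₃.symm (sub a₄) (sub a₁₀) (sub a₉) a₁₅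
      a₃ a₂ a₁₁ (sub a₈) a₁₄ a₁₃ hC e₁₃ e₀₁ e₁₂ e₀₃ e₂₃ g₀ g₂ ⟨z, hzC, h, by simp [z₁, z₃]⟩
  · exact theta_of_complete_four h₂₃ h₀₂.symm h₁₂.symm h₀₃.symm h₁₃.symm (sub a₁₂) (sub a₁₄)
      (sub a₁₃) (sub a₁₅) a₆ a₅ a₇ (sub a₈) a₁₀ a₉ hC e₂₃ e₀₂ e₁₂ e₀₃ e₁₃ g₀ g₁
      ⟨z, hzC, h, by simp [z₂, z₃]⟩

end PlaneTopology

/-! ### Outerplanar graphs are 2-degenerate -/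

namespace SimpleGraph

open Set PlaneTopology

variable {V : Type*} {G : SimpleGraph V}

/-! ### Walks in an embedding and crossing chords -/

namespace PlanarEmbedding

variable (P : G.PlanarEmbedding)

/-- The union of the arcs of the walk `f s, f (s + 1), …, f t`. -/
def trail (f : ℕ → V) (s t : ℕ) : Set (EuclideanSpace ℝ (Fin 2)) :=
  ⋃ k ∈ Ico s t, P.arc s(f k, f (k + 1))

theorem trail_self_succ (f : ℕ → V) (s : ℕ) :
    P.trail f s (s + 1) = P.arc s(f s, f (s + 1)) := by
  have : Ico s (s + 1) = {s} := by
    ext x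
    simp only [mem_Ico, mem_singleton_iff]
    omega
  rw [trail, this, biUnion_singleton]

/-- Distinct edges meet only in common ends. An edge shared by both walks is impossible, since it
would put two distinct vertices into the subsingleton `C`. -/
theorem trail_inter_trail_subset {f g : ℕ → V} {s t s' t' : ℕ}
    (hf : ∀ k ∈ Ico s t, G.Adj (f k) (f (k + 1)))
    (hg : ∀ k ∈ Ico s' t', G.Adj (g k) (g (k + 1))) {C : Set V} (hC : C.Subsingleton)
    (h : ∀ a ∈ Icc s t, ∀ b ∈ Icc s' t', f a = g b → f a ∈ C) :
    P.trail f s t ∩ P.trail g s' t' ⊆ P.pt '' C := by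
  rintro z ⟨hz, hz'⟩
  simp only [trail, mem_iUnion] at hz hz'
  obtain ⟨k, hk, hz⟩ := hz
  obtain ⟨l, hl, hz'⟩ := hz'
  have hk0 : k ∈ Icc s t := ⟨hk.1, hk.2.le⟩
  have hk1 : k + 1 ∈ Icc s t := ⟨hk.1.trans k.le_succ, hk.2⟩
  have hl0 : l ∈ Icc s' t' := ⟨hl.1, hl.2.le⟩
  have hl1 : l + 1 ∈ Icc s' t' := ⟨hl.1.trans l.le_succ, hl.2⟩
  have hmem : ∀ v, v ∈ s(f k, f (k + 1)) → v ∈ s(g l, g (l + 1)) → v ∈ C := by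
    intro v hv hv'
    rw [Sym2.mem_iff] at hv hv'
    rcases hv with rfl | rfl <;> rcases hv' with hv' | hv'
    · exact h _ hk0 _ hl0 hv'
    · exact h _ hk0 _ hl1 hv'
    · exact h _ hk1 _ hl0 hv'
    · exact h _ hk1 _ hl1 hv'
  have hne : s(f k, f (k + 1)) ≠ s(g l, g (l + 1)) := by
    intro he
    exact (hf k hk).ne (hC (hmem _ (Sym2.mem_mk_left _ _) (he ▸ Sym2.mem_mk_left _ _))
      (hmem _ (Sym2.mem_mk_right _ _) (he ▸ Sym2.mem_mk_right _ _)))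
  exact image_mono (fun v hv => hmem v hv.1 hv.2)
    (P.arc_inter _ (hf k hk) _ (hg l hl) hne ⟨hz, hz'⟩)

theorem isArcLike_arc {u v : V} (h : G.Adj u v) :
    IsArcLike (P.arc s(u, v)) (P.pt u) (P.pt v) := by
  obtain ⟨γ, hγ, hr⟩ := P.isSimpleArc u v h
  rw [← hr]
  exact .of_path γ hγ

theorem isArcLike_trail {f : ℕ → V} {s t : ℕ} (hst : s < t) (hinj : InjOn f (Icc s t))
    (hf : ∀ k ∈ Ico s t, G.Adj (f k) (f (k + 1))) :
    IsArcLike (P.trail f s t) (P.pt (f s)) (P.pt (f t)) := by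
  induction t, hst using Nat.le_induction with
  | base =>
    rw [Nat.succ_eq_add_one, trail_self_succ]
    exact P.isArcLike_arc (hf s (by simp))
  | succ t ht ih =>
    have hst : s ≤ t := by omega
    have h1 : P.trail f s (t + 1) = P.trail f s t ∪ P.trail f t (t + 1) := by
      unfold trail
      rw [← biUnion_union, Ico_union_Ico_eq_Ico hst t.le_succ]
    have h2 := P.trail_self_succ f t
    have hf' : ∀ k ∈ Ico s t, G.Adj (f k) (f (k + 1)) := fun k hk =>
      hf k ⟨hk.1, hk.2.trans t.lt_succ_self⟩
    have hft : ∀ k ∈ Ico t (t + 1), G.Adj (f k) (f (k + 1)) := fun k hk =>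
      hf k ⟨hst.trans hk.1, hk.2⟩
    rw [h1]
    refine (ih (hinj.mono (Icc_subset_Icc_right t.le_succ)) hf').trans ?_
      (w := P.pt (f (t + 1))) ?_
    · rw [h2]; exact P.isArcLike_arc (hf t ⟨hst, t.lt_succ_self⟩)
    · refine (P.trail_inter_trail_subset hf' hft (C := {f t}) subsingleton_singleton ?_).trans
        (by simp)
      intro a ha b hb hab
      have : a = b := hinj ⟨ha.1, ha.2.trans t.le_succ⟩ ⟨hst.trans hb.1, hb.2⟩ hab
      obtain rfl : a = t := le_antisymm ha.2 (this ▸ hb.1)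
      rfl

/-- A path with chords from its first vertex to the `i`-th and `j`-th and from its `(i - 1)`-st
vertex to the `k`-th, where `i < k ≤ j`, is a subdivision of `K₄`. -/
theorem not_crossing_chords {F : Set (EuclideanSpace ℝ (Fin 2))} (hF : IsPreconnected F)
    (hFP : Disjoint F P.support) (hcl : ∀ v, P.pt v ∈ closure F) {f : ℕ → V} {i j k : ℕ}
    (hi : 2 ≤ i) (hik : i < k) (hkj : k ≤ j) (hinj : InjOn f (Iic j))
    (hadj : ∀ l < j, G.Adj (f l) (f (l + 1))) (h₁ : G.Adj (f 0) (f i)) (h₂ : G.Adj (f 0) (f j))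
    (h₃ : G.Adj (f (i - 1)) (f k)) : False := by
  have hinj' : ∀ {a b}, a ≤ j → b ≤ j → f a = f b → a = b := fun ha hb h => hinj ha hb h
  -- All six arcs are written as trails of `f` after reindexing: `e a b` turns a single edge into a
  -- walk, and `c` sends `j + 1` to 0, so that the walk from `k` to `j` continues along the chord to
  -- `f 0`.
  let e : ℕ → ℕ → ℕ → ℕ := fun a b l => if l = 0 then a else b
  let c : ℕ → ℕ := fun l => if l ≤ j then l else 0
  have hdisj : ∀ {g : ℕ → V} {s t}, (∀ l ∈ Ico s t, G.Adj (g l) (g (l + 1))) →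
      Disjoint F (P.trail g s t) := by
    intro g s t hg
    refine hFP.mono_right (subset_trans ?_ subset_union_right)
    refine iUnion₂_subset fun l hl => ?_
    exact subset_biUnion_of_mem (u := fun e => P.arc e) (show s(g l, g (l + 1)) ∈ G.edgeSet from hg l hl)
  have inter : ∀ {φ ψ : ℕ → ℕ} {s t s' t' : ℕ} (d : ℕ),
      (∀ l ∈ Ico s t, G.Adj ((f ∘ φ) l) ((f ∘ φ) (l + 1))) →
      (∀ l ∈ Ico s' t', G.Adj ((f ∘ ψ) l) ((f ∘ ψ) (l + 1))) →
      (∀ a ∈ Icc s t, φ a ≤ j) → (∀ a ∈ Icc s' t', ψ a ≤ j) →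
      (∀ a ∈ Icc s t, ∀ b ∈ Icc s' t', φ a = ψ b → φ a = d) →
      P.trail (f ∘ φ) s t ∩ P.trail (f ∘ ψ) s' t' ⊆ {P.pt (f d)} := by
    intro φ ψ s t s' t' d hφ hψ bφ bψ h
    refine (P.trail_inter_trail_subset hφ hψ (C := {f d}) subsingleton_singleton ?_).trans
      (by simp)
    intro a ha b hb hab
    rw [mem_singleton_iff, Function.comp_apply, h a ha b hb (hinj' (bφ a ha) (bψ b hb) hab)]
  have inter' : ∀ {φ ψ : ℕ → ℕ} {s t s' t' : ℕ},
      (∀ l ∈ Ico s t, G.Adj ((f ∘ φ) l) ((f ∘ φ) (l + 1))) →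
      (∀ l ∈ Ico s' t', G.Adj ((f ∘ ψ) l) ((f ∘ ψ) (l + 1))) →
      (∀ a ∈ Icc s t, φ a ≤ j) → (∀ a ∈ Icc s' t', ψ a ≤ j) →
      (∀ a ∈ Icc s t, ∀ b ∈ Icc s' t', φ a ≠ ψ b) →
      P.trail (f ∘ φ) s t ∩ P.trail (f ∘ ψ) s' t' ⊆ ∅ := by
    intro φ ψ s t s' t' hφ hψ bφ bψ h
    refine (P.trail_inter_trail_subset hφ hψ (C := ∅) subsingleton_empty ?_).trans
      (by simp)
    intro a ha b hb hab
    exact (h a ha b hb (hinj' (bφ a ha) (bψ b hb) hab)).elim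
  have ae : ∀ {a b}, G.Adj (f a) (f b) →
      ∀ l ∈ Ico 0 1, G.Adj ((f ∘ e a b) l) ((f ∘ e a b) (l + 1)) := by
    intro a b h l hl
    obtain rfl : l = 0 := by simpa using hl
    simpa [e] using h
  have ai : ∀ {s t}, t ≤ j → ∀ l ∈ Ico s t, G.Adj ((f ∘ id) l) ((f ∘ id) (l + 1)) :=
    fun ht l hl => hadj l (hl.2.trans_le ht)
  have ac : ∀ l ∈ Ico k (j + 1), G.Adj ((f ∘ c) l) ((f ∘ c) (l + 1)) := by
    intro l hl
    rcases (Nat.lt_succ_iff.1 hl.2).eq_or_lt with rfl | hlj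
    · simpa [c] using h₂.symm
    · have : l + 1 ≤ j := hlj
      simpa [c, this, hlj.le] using hadj l hlj
  have be : ∀ {a b}, a ≤ j → b ≤ j → ∀ l ∈ Icc 0 1, e a b l ≤ j := by
    intro a b ha hb l _
    simp only [e]; split_ifs <;> assumption
  have bi : ∀ {s t}, t ≤ j → ∀ l ∈ Icc s t, id l ≤ j := fun ht l hl => hl.2.trans ht
  have bc : ∀ l ∈ Icc k (j + 1), c l ≤ j := by
    intro l _
    simp only [c]; split_ifs <;> omega
  have arclike : ∀ {φ : ℕ → ℕ} {s t : ℕ}, s < t →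
      (∀ l ∈ Ico s t, G.Adj ((f ∘ φ) l) ((f ∘ φ) (l + 1))) → (∀ a ∈ Icc s t, φ a ≤ j) →
      InjOn φ (Icc s t) →
      IsArcLike (P.trail (f ∘ φ) s t) (P.pt (f (φ s))) (P.pt (f (φ t))) := by
    intro φ s t hst hφ bφ hi
    exact P.isArcLike_trail hst (hinj.comp hi fun a ha => bφ a ha) hφ
  have ie : ∀ {a b}, a ≠ b → InjOn (e a b) (Icc 0 1) := by
    intro a b hab x hx y hy hxy
    have := hx.2
    have := hy.2
    simp only [e] at hxy
    split_ifs at hxy <;> omega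
  have ic : InjOn c (Icc k (j + 1)) := by
    intro x hx y hy hxy
    have := hx.1
    have := hy.1
    have := hx.2
    have := hy.2
    simp only [c] at hxy
    split_ifs at hxy <;> omega
  have h₁₂ : G.Adj (f (i - 1)) (f i) := by
    have := hadj (i - 1) (by omega)
    rwa [Nat.sub_add_cancel (by omega)] at this
  have l₀₁ := arclike (φ := id) (s := 0) (t := i - 1) (by omega) (ai (by omega)) (bi (by omega))
    (injOn_id _)
  have l₀₂ := arclike (φ := e 0 i) zero_lt_one (ae h₁) (be (by omega) (by omega)) (ie (by omega))
  have l₁₂ := arclike (φ := e (i - 1) i) zero_lt_one (ae h₁₂) (be (by omega) (by omega))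
    (ie (by omega))
  have l₁₃ := arclike (φ := e (i - 1) k) zero_lt_one (ae h₃) (be (by omega) (by omega))
    (ie (by omega))
  have l₂₃ := arclike (φ := id) hik (ai hkj) (bi hkj) (injOn_id _)
  have l₃₀ := arclike (φ := c) (s := k) (t := j + 1) (by omega) ac bc ic
  simp only [e, c, id, one_ne_zero, hkj, Nat.not_succ_le_self,
    ↓reduceIte] at l₀₁ l₀₂ l₁₂ l₁₃ l₂₃ l₃₀
  -- The branch vertices are `f 0`, `f (i - 1)`, `f i` and `f k`. Disjointness of the six arcs
  -- reduces to comparing indices, since `f` is injective up to `j`.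
  refine complete_four l₀₁ l₀₂ l₃₀.symm l₁₂ l₁₃ l₂₃ ?_ ?_ ?_ ?_ ?_ ?_ ?_ ?_ ?_ ?_ ?_ ?_ ?_ ?_ ?_
    hF (hdisj (ai (by omega))) (hdisj (ae h₁)) (hdisj ac) (hdisj (ae h₁₂)) (hdisj (ae h₃))
    (hdisj (ai hkj)) (hcl _) (hcl _) (hcl _) (hcl _)
  all_goals
    first
    | refine inter _ ?_ ?_ ?_ ?_ ?_
    | refine inter' ?_ ?_ ?_ ?_ ?_
  all_goals
    first
    | exact ai (by omega)
    | exact ae (by assumption)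
    | exact ac
    | exact bi (by omega)
    | exact be (by omega) (by omega)
    | exact bc
    | skip
  all_goals
    intro a ha b hb
    have ha₁ := ha.1
    have ha₂ := ha.2
    have hb₁ := hb.1
    have hb₂ := hb.2
    try simp only [id, e, c]
    (repeat' split_ifs) <;> omega

end PlanarEmbedding
end SimpleGraph

/-! ### Longest paths and 2-degeneracy -/

namespace SimpleGraph

open Set

variable {V : Type*} {G : SimpleGraph V}

/-- `f 0, …, f n` is a path of `G` in `W`. -/
structure IsPathIn (G : SimpleGraph V) (W : Finset V) (f : ℕ → V) (n : ℕ) : Prop where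
  mem : ∀ k ≤ n, f k ∈ W
  injOn : InjOn f (Iic n)
  adj : ∀ k < n, G.Adj (f k) (f (k + 1))

namespace IsPathIn

variable {W : Finset V} {f : ℕ → V} {n : ℕ}

theorem lt_card (h : G.IsPathIn W f n) : n < W.card := by
  have := Finset.card_le_card_of_injOn (s := Finset.range (n + 1)) (t := W) f
    (fun k hk => h.mem k (by simpa [Nat.lt_succ_iff] using hk))
    (fun a ha b hb hab => h.injOn (by simpa [Nat.lt_succ_iff] using ha)
      (by simpa [Nat.lt_succ_iff] using hb) hab)
  simpa using this

theorem cons (h : G.IsPathIn W f n) {w : V} (hw : w ∈ W) (hadj : G.Adj w (f 0))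
    (hne : ∀ k ≤ n, f k ≠ w) :
    G.IsPathIn W (fun k => if k = 0 then w else f (k - 1)) (n + 1) := by
  refine ⟨fun k hk => ?_, fun a ha b hb hab => ?_, fun k hk => ?_⟩
  · split_ifs
    · exact hw
    · exact h.mem _ (by omega)
  · have ha' : a ≤ n + 1 := ha
    have hb' : b ≤ n + 1 := hb
    split_ifs at hab with h1 h2 h2
    · omega
    · exact (hne _ (by omega) hab.symm).elim
    · exact (hne _ (by omega) hab).elim
    · have := h.injOn (show a - 1 ≤ n by omega) (show b - 1 ≤ n by omega) hab
      omega
  · rcases Nat.eq_zero_or_pos k with rfl | hk0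
    · simpa using hadj
    · have := h.adj (k - 1) (by omega)
      rw [Nat.sub_add_cancel hk0] at this
      simpa [hk0.ne'] using this

/-- Rotating a path about a chord from its first vertex. -/
theorem rotate (h : G.IsPathIn W f n) {i : ℕ} (hi : 0 < i) (hin : i ≤ n)
    (hadj : G.Adj (f 0) (f i)) :
    G.IsPathIn W (fun k => if k < i then f (i - 1 - k) else f k) n := by
  refine ⟨fun k hk => ?_, fun a ha b hb hab => ?_, fun k hk => ?_⟩
  · split_ifs
    · exact h.mem _ (by omega)
    · exact h.mem _ hk
  · have ha' : a ≤ n := ha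
    have hb' : b ≤ n := hb
    split_ifs at hab with h1 h2 h2
    · have := h.injOn (show i - 1 - a ≤ n by omega) (show i - 1 - b ≤ n by omega) hab
      omega
    · have := h.injOn (show i - 1 - a ≤ n by omega) hb hab
      omega
    · have := h.injOn ha (show i - 1 - b ≤ n by omega) hab
      omega
    · exact h.injOn ha hb hab
  · rcases lt_trichotomy (k + 1) i with h1 | h1 | h1
    · have h2 := h.adj (i - 1 - (k + 1)) (by omega)
      have h3 : i - 1 - (k + 1) + 1 = i - 1 - k := by omega
      rw [h3] at h2
      simpa [h1, show k < i by omega] using h2.symm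
    · subst h1
      simpa using hadj
    · simpa [show ¬ k < i by omega, show ¬ k + 1 < i by omega] using h.adj k hk

end IsPathIn

/-- If every vertex of `W` has at least three neighbours in `W`, then there are a path and chords as
in `PlanarEmbedding.not_crossing_chords`. -/
theorem exists_crossing_chords {W : Finset V} (hW : W.Nonempty)
    (hdeg : ∀ v ∈ W, ∀ a b, ∃ w ∈ W, G.Adj v w ∧ w ≠ a ∧ w ≠ b) :
    ∃ (f : ℕ → V) (i j k : ℕ), 2 ≤ i ∧ i < k ∧ k ≤ j ∧ InjOn f (Iic j) ∧
      (∀ l < j, G.Adj (f l) (f (l + 1))) ∧ G.Adj (f 0) (f i) ∧ G.Adj (f 0) (f j) ∧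
      G.Adj (f (i - 1)) (f k) := by
  classical
  obtain ⟨n, ⟨f₀, hf₀⟩, hmax⟩ : ∃ n, (∃ f, G.IsPathIn W f n) ∧ ∀ f, ¬ G.IsPathIn W f (n + 1) := by
    by_contra! h
    have : ∀ n, ∃ f, G.IsPathIn W f n := by
      intro n
      induction n with
      | zero =>
        obtain ⟨v, hv⟩ := hW
        exact ⟨fun _ => v, fun _ _ => hv, fun a ha b hb _ => by simp at ha hb; omega,
          fun k hk => by omega⟩
      | succ n ih => exact h n ih
    obtain ⟨f, hf⟩ := this W.card
    exact hf.lt_card.false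
  -- On a longest path every neighbour of the first vertex is on the path, as it could otherwise be
  -- prepended.
  have hnbr : ∀ f, G.IsPathIn W f n → ∀ w ∈ W, G.Adj (f 0) w → ∃ m ≤ n, 1 ≤ m ∧ f m = w := by
    intro f hf w hw hadj
    by_contra! hne
    refine hmax _ (hf.cons hw hadj.symm fun k hk => ?_)
    rcases Nat.eq_zero_or_pos k with rfl | hk0
    · exact hadj.ne
    · exact hne k hk hk0
  -- The index `i` is minimised over all paths of maximal length simultaneously, so that its
  -- minimality also applies to the rotated path.
  have hex : ∃ i, 2 ≤ i ∧ ∃ f, G.IsPathIn W f n ∧ i ≤ n ∧ G.Adj (f 0) (f i) := by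
    obtain ⟨w, hw, hadj, hw1, -⟩ := hdeg _ (hf₀.mem 0 n.zero_le) (f₀ 1) (f₀ 1)
    obtain ⟨m, hm, hm1, rfl⟩ := hnbr f₀ hf₀ w hw hadj
    refine ⟨m, ?_, f₀, hf₀, hm, hadj⟩
    rcases hm1.eq_or_lt with rfl | h
    · exact (hw1 rfl).elim
    · exact h
  obtain ⟨hi, f, hf, hin, hadj⟩ := Nat.find_spec hex
  have hmin := fun m => Nat.find_min' hex (m := m)
  set i := Nat.find hex
  have hthird : ∀ g, G.IsPathIn W g n → ∃ j, i < j ∧ j ≤ n ∧ G.Adj (g 0) (g j) := by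
    intro g hg
    obtain ⟨w, hw, hadj', hw1, hwi⟩ := hdeg _ (hg.mem 0 n.zero_le) (g 1) (g i)
    obtain ⟨m, hm, hm1, rfl⟩ := hnbr g hg w hw hadj'
    have hm2 : 2 ≤ m := by
      rcases hm1.eq_or_lt with rfl | h
      · exact (hw1 rfl).elim
      · exact h
    have him : i ≤ m := hmin m ⟨hm2, g, hg, hm, hadj'⟩
    refine ⟨m, lt_of_le_of_ne him ?_, hm, hadj'⟩
    rintro rfl
    exact hwi rfl
  -- The rotated path starts at `f (i - 1)`, runs back to `f 0` and continues from `f i`. It is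
  -- unchanged from index `i` on, so its third chord joins `f (i - 1)` to `f k` with `i < k`.
  have hrot := hf.rotate (by omega) hin hadj
  obtain ⟨j, hij, hjn, hj⟩ := hthird f hf
  obtain ⟨k, hik, hkn, hk⟩ := hthird _ hrot
  rcases le_total k j with hkj | hjk
  · refine ⟨f, i, j, k, hi, hik, hkj, hf.injOn.mono (Iic_subset_Iic.2 hjn),
      fun l hl => hf.adj l (by omega), hadj, hj, ?_⟩
    simpa [show ¬ k < i by omega, show 0 < i by omega] using hk
  -- Here the two paths exchange roles: in the rotated path, the old edge from `f (i - 1)` to `f i`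
  -- is the short chord, and `f 0` sits at index `i - 1`.
  · refine ⟨_, i, k, j, hi, hij, hjk, hrot.injOn.mono (Iic_subset_Iic.2 hkn),
      fun l hl => hrot.adj l (by omega), ?_, hk, ?_⟩
    · have := hf.adj (i - 1) (by omega)
      rw [Nat.sub_add_cancel (by omega)] at this
      simpa [show 0 < i by omega] using this
    · simpa [show ¬ j < i by omega, show i - 1 < i by omega] using hj

theorem IsOuterplanar.exists_le_two_neighbors (hG : G.IsOuterplanar) {W : Finset V}
    (hW : W.Nonempty) : ∃ v ∈ W, ∃ a b, ∀ w ∈ W, G.Adj v w → w = a ∨ w = b := by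
  by_contra! h
  obtain ⟨f, i, j, k, hi, hik, hkj, hinj, hadj, h₁, h₂, h₃⟩ := exists_crossing_chords hW h
  obtain ⟨P, F, ⟨⟨x, hx, rfl⟩, -⟩, hcl⟩ := hG
  exact P.not_crossing_chords isPreconnected_connectedComponentIn
    (Set.disjoint_left.2 fun y hy => connectedComponentIn_subset _ _ hy)
    (fun v => frontier_subset_closure (hcl v)) hi hik hkj hinj hadj h₁ h₂ h₃

/-- Induction along the degeneracy: a vertex with at most two neighbours in `W` receives all its
edges within `W` as incoming arcs, and a colour different from those of its neighbours. -/
theorem IsOuterplanar.exists_orientation_coloring (hG : G.IsOuterplanar) (W : Finset V) :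
    ∃ (D : V → V → Prop) (c : V → Fin 3), (∀ u v, D u v → u ∈ W ∧ v ∈ W ∧ G.Adj u v) ∧
      (∀ u ∈ W, ∀ v ∈ W, G.Adj u v → Xor (D u v) (D v u)) ∧
      (∀ v, ∃ a b, ∀ u, D u v → u = a ∨ u = b) ∧ ∀ u ∈ W, ∀ v ∈ W, G.Adj u v → c u ≠ c v := by
  classical
  induction W using Finset.strongInduction with
  | H W ih =>
    rcases W.eq_empty_or_nonempty with rfl | hW
    · exact ⟨fun _ _ => False, fun _ => 0, by simp, by simp, fun v => ⟨v, v, by simp⟩, by simp⟩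
    obtain ⟨v, hv, a, b, hab⟩ := hG.exists_le_two_neighbors hW
    obtain ⟨D, c, h₁, h₂, h₃, h₄⟩ := ih (W.erase v) (Finset.erase_ssubset hv)
    obtain ⟨x, hxa, hxb⟩ : ∃ x : Fin 3, x ≠ c a ∧ x ≠ c b := by
      generalize c a = p
      generalize c b = q
      decide +revert
    have hDv : ∀ u, ¬ D u v ∧ ¬ D v u := fun u =>
      ⟨fun h => by simpa using (h₁ _ _ h).2.1, fun h => by simpa using (h₁ _ _ h).1⟩
    refine ⟨fun u w => D u w ∨ (w = v ∧ u ∈ W ∧ G.Adj u v), fun u => if u = v then x else c u,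
      ?_, ?_, ?_, ?_⟩
    · rintro u w (h | ⟨rfl, hu, hadj⟩)
      · obtain ⟨p, q, r⟩ := h₁ _ _ h
        exact ⟨Finset.mem_of_mem_erase p, Finset.mem_of_mem_erase q, r⟩
      · exact ⟨hu, hv, hadj⟩
    · intro u hu w hw hadj
      by_cases huv : u = v
      · subst huv
        have : w ≠ u := hadj.ne'
        refine Or.inr ⟨Or.inr ⟨rfl, hw, hadj.symm⟩, ?_⟩
        simp [this, hDv w]
      · by_cases hwv : w = v
        · subst hwv
          refine Or.inl ⟨Or.inr ⟨rfl, hu, hadj⟩, ?_⟩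
          simp [huv, hDv u]
        · simpa [huv, hwv] using h₂ u (Finset.mem_erase.2 ⟨huv, hu⟩) w
            (Finset.mem_erase.2 ⟨hwv, hw⟩) hadj
    · intro w
      by_cases hwv : w = v
      · subst hwv
        refine ⟨a, b, fun u hu => ?_⟩
        rcases hu with hu | ⟨-, hu, hadj⟩
        · exact ((hDv u).1 hu).elim
        · exact hab u hu hadj.symm
      · obtain ⟨p, q, hpq⟩ := h₃ w
        exact ⟨p, q, fun u hu => hpq u (by simpa [hwv] using hu)⟩
    · intro u hu w hw hadj
      by_cases huv : u = v
      · subst huv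
        have hwu : w ≠ u := hadj.ne'
        rcases hab w hw hadj with rfl | rfl <;> simpa [hwu]
      · by_cases hwv : w = v
        · subst hwv
          rcases hab u hu hadj.symm with rfl | rfl <;> simpa [huv] using Ne.symm ‹_›
        · simpa [huv, hwv] using h₄ u (Finset.mem_erase.2 ⟨huv, hu⟩) w
            (Finset.mem_erase.2 ⟨hwv, hw⟩) hadj

/-! ### The upper bound -/

theorem exists_pos_weights {α : Type*} {s : Finset α} (hs : s.Nonempty) {t : ℕ}
    (ht : s.card ≤ t) : ∃ w : α → ℕ, (∀ a ∈ s, 0 < w a) ∧ ∑ a ∈ s, w a = t := by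
  classical
  obtain ⟨a, ha⟩ := hs
  refine ⟨fun b => 1 + if b = a then t - s.card else 0, fun b _ => by positivity, ?_⟩
  rw [Finset.sum_add_distrib, Finset.sum_ite_eq' s a]
  simp only [ha, if_true, Finset.sum_const, smul_eq_mul, mul_one]
  omega

theorem IsOuterplanar.semiProperOrientationNumber_le [Fintype V] (hG : G.IsOuterplanar) :
    G.semiProperOrientationNumber ≤ 4 := by
  classical
  obtain ⟨D, c, h₁, h₂, h₃, h₄⟩ := hG.exists_orientation_coloring Finset.univ
  let N : V → Finset V := fun v => Finset.univ.filter fun u => D u v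
  have hN : ∀ v, (N v).card ≤ 2 := by
    intro v
    obtain ⟨a, b, hab⟩ := h₃ v
    refine (Finset.card_le_card (t := {a, b}) fun u hu => ?_).trans Finset.card_le_two
    simpa using hab u (by simpa [N] using hu)
  -- Starting the targets at 2 makes them at least the in-degree, hence attainable by positive
  -- weights, and keeps them apart from the in-weight 0 of sources.
  have hw : ∀ v, ∃ w : V → ℕ, (∀ u ∈ N v, 0 < w u) ∧
      ((N v).Nonempty → ∑ u ∈ N v, w u = 2 + (c v : ℕ)) := by
    intro v
    by_cases hv : (N v).Nonempty
    · obtain ⟨w, hw, hs⟩ := exists_pos_weights hv (t := 2 + (c v : ℕ))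
        ((hN v).trans (Nat.le_add_right _ _))
      exact ⟨w, hw, fun _ => hs⟩
    · exact ⟨fun _ => 1, fun _ _ => one_pos, fun h => (hv h).elim⟩
  choose w hwpos hwsum using hw
  let D' : Digraph V := ⟨D⟩
  have hin : ∀ v, inWeight D' (fun u v => w v u) v = ∑ u ∈ N v, w v u := by
    intro v
    unfold inWeight
    congr 1
  have hzero : ∀ v, ¬ (N v).Nonempty → inWeight D' (fun u v => w v u) v = 0 := by
    intro v hv
    rw [hin, Finset.not_nonempty_iff_eq_empty.1 hv, Finset.sum_empty]
  have hpos : ∀ v, (N v).Nonempty → inWeight D' (fun u v => w v u) v = 2 + (c v : ℕ) := by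
    intro v hv
    rw [hin, hwsum v hv]
  let O : G.SemiProperOrientation :=
    { D := D'
      isOrientation := ⟨fun u v h => (h₁ u v h).2.2,
        fun u v h => h₂ u (Finset.mem_univ _) v (Finset.mem_univ _) h⟩
      weight := fun u v => w v u
      weight_pos := fun u v h => hwpos v u (by simpa [N] using h)
      proper := by
        intro u v h
        have hc : (c u : ℕ) ≠ c v := fun e =>
          h₄ u (Finset.mem_univ _) v (Finset.mem_univ _) h (Fin.ext e)
        by_cases hu : (N u).Nonempty <;> by_cases hv : (N v).Nonempty
        · rw [hpos u hu, hpos v hv]; omega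
        · rw [hpos u hu, hzero v hv]; omega
        · rw [hzero u hu, hpos v hv]; omega
        · exfalso
          rcases h₂ u (Finset.mem_univ _) v (Finset.mem_univ _) h with h | h
          · exact hv ⟨u, by simpa [N] using h.1⟩
          · exact hu ⟨v, by simpa [N] using h.1⟩ }
  refine (iInf_le _ O).trans ?_
  have : O.maxInWeight ≤ 4 := by
    refine Finset.sup_le fun v _ => ?_
    by_cases hv : (N v).Nonempty
    · change inWeight D' (fun u v => w v u) v ≤ 4
      rw [hpos v hv]; omega
    · change inWeight D' (fun u v => w v u) v ≤ 4
      rw [hzero v hv]; omega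
  exact_mod_cast this

end SimpleGraph

/-! ### Straight-line drawings with vertices on a parabola -/

namespace SimpleGraph

open Set Topology

/-- The point of the parabola `y = x ^ 2` with abscissa `s`. -/
noncomputable def parabolaPoint (s : ℝ) : EuclideanSpace ℝ (Fin 2) := !₂[s, s ^ 2]

@[simp] theorem parabolaPoint_zero (s : ℝ) : parabolaPoint s 0 = s := rfl

@[simp] theorem parabolaPoint_one (s : ℝ) : parabolaPoint s 1 = s ^ 2 := rfl

theorem parabolaPoint_injective : Function.Injective parabolaPoint := fun s t h => by
  simpa using congrArg (fun z : EuclideanSpace ℝ (Fin 2) => z 0) h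

theorem eq_parabolaPoint {z : EuclideanSpace ℝ (Fin 2)} {s : ℝ} (h₀ : z 0 = s)
    (h₁ : z 1 = s ^ 2) : z = parabolaPoint s := by
  ext i
  fin_cases i
  · exact h₀
  · exact h₁

theorem mem_chord {s t : ℝ} {z : EuclideanSpace ℝ (Fin 2)}
    (hz : z ∈ segment ℝ (parabolaPoint s) (parabolaPoint t)) :
    z 1 = (s + t) * z 0 - s * t ∧ 0 ≤ (z 0 - s) * (t - z 0) := by
  obtain ⟨a, b, ha, hb, hab, rfl⟩ := hz
  obtain rfl : a = 1 - b := by linarith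
  simp only [PiLp.add_apply, PiLp.smul_apply, parabolaPoint_zero, parabolaPoint_one, smul_eq_mul]
  refine ⟨by ring, ?_⟩
  have : ((1 - b) * s + b * t - s) * (t - ((1 - b) * s + b * t)) = b * (1 - b) * (t - s) ^ 2 := by
    ring
  rw [this]
  positivity

theorem mem_chord_of_lt {s t : ℝ} (hst : s < t) {z : EuclideanSpace ℝ (Fin 2)}
    (hz : z ∈ segment ℝ (parabolaPoint s) (parabolaPoint t)) :
    z 1 = (s + t) * z 0 - s * t ∧ s ≤ z 0 ∧ z 0 ≤ t := by
  obtain ⟨h, h'⟩ := mem_chord hz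
  refine ⟨h, ?_, ?_⟩ <;> by_contra! hc <;> nlinarith

theorem parabolaPoint_mem_chord {s t r : ℝ}
    (h : parabolaPoint r ∈ segment ℝ (parabolaPoint s) (parabolaPoint t)) : r = s ∨ r = t := by
  obtain ⟨h, -⟩ := mem_chord h
  simp only [parabolaPoint_zero, parabolaPoint_one] at h
  have : (r - s) * (r - t) = 0 := by linear_combination h
  rcases mul_eq_zero.1 this with h | h
  · exact Or.inl (sub_eq_zero.1 h)
  · exact Or.inr (sub_eq_zero.1 h)

/-- Two distinct non-crossing chords of the parabola meet only in common ends. -/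
theorem chord_inter_chord {s t u v : ℝ} (hst : s < t) (huv : u < v)
    (h₁ : ¬ (s < u ∧ u < t ∧ t < v)) (h₂ : ¬ (u < s ∧ s < v ∧ v < t)) (hne : ¬ (s = u ∧ t = v))
    {z : EuclideanSpace ℝ (Fin 2)} (hz : z ∈ segment ℝ (parabolaPoint s) (parabolaPoint t))
    (hz' : z ∈ segment ℝ (parabolaPoint u) (parabolaPoint v)) :
    ∃ r, z = parabolaPoint r ∧ (r = s ∨ r = t) ∧ (r = u ∨ r = v) := by
  obtain ⟨e, hs, ht⟩ := mem_chord_of_lt hst hz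
  obtain ⟨e', hu, hv⟩ := mem_chord_of_lt huv hz'
  generalize hx : z 0 = x at *
  -- Both sides are the height of the common point above the parabola. For nested intervals without
  -- a common end the outer chord is strictly higher, which is the content of `nested`.
  have key : (x - s) * (t - x) = (x - u) * (v - x) := by linear_combination e' - e
  suffices h : (x = s ∨ x = t) ∧ (x = u ∨ x = v) by
    refine ⟨x, eq_parabolaPoint hx ?_, h⟩
    rcases h.1 with rfl | rfl <;> rw [e] <;> ring
  have nested : ∀ {a b c d : ℝ}, a ≤ x → x ≤ b → c ≤ a → b ≤ d →
      (x - a) * (b - x) = (x - c) * (d - x) → ¬ (a = c ∧ b = d) →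
      (x = a ∨ x = b) ∧ (x = c ∨ x = d) := by
    intro a b c d h1 h2 h3 h4 h5 h6
    rcases h3.eq_or_lt with rfl | h3
    · have hbd : b ≠ d := fun h => h6 ⟨rfl, h⟩
      have : (x - c) * (d - b) = 0 := by linear_combination -h5
      rcases mul_eq_zero.1 this with h | h
      · have := sub_eq_zero.1 h; exact ⟨Or.inl this, Or.inl this⟩
      · exact (hbd (sub_eq_zero.1 h).symm).elim
    · rcases h4.eq_or_lt with rfl | h4
      · have : (b - x) * (a - c) = 0 := by linear_combination -h5
        rcases mul_eq_zero.1 this with h | h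
        · have := (sub_eq_zero.1 h).symm; exact ⟨Or.inr this, Or.inr this⟩
        · linarith
      · exfalso
        nlinarith [mul_nonneg (sub_nonneg.2 h1) (sub_nonneg.2 h2),
          mul_pos (sub_pos.2 h3) (sub_pos.2 h4), mul_nonneg (sub_nonneg.2 h1) (sub_pos.2 h4).le,
          mul_nonneg (sub_nonneg.2 h2) (sub_pos.2 h3).le]
  rcases lt_trichotomy s u with h | h | h
  · rcases le_or_gt t u with h' | h'
    · have a : x = t := by linarith
      have b : x = u := by linarith
      exact ⟨Or.inr a, Or.inl b⟩
    · have h'' : v ≤ t := not_lt.1 fun h'' => h₁ ⟨h, h', h''⟩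
      exact (nested hu hv h.le h'' key.symm fun hh => hne ⟨hh.1.symm, hh.2.symm⟩).symm
  · rcases le_total t v with h' | h'
    · exact nested hs ht h.ge h' key hne
    · exact (nested hu hv h.le h' key.symm fun hh => hne ⟨hh.1.symm, hh.2.symm⟩).symm
  · rcases le_or_gt v s with h' | h'
    · have a : x = s := by linarith
      have b : x = v := by linarith
      exact ⟨Or.inl a, Or.inr b⟩
    · have h'' : t ≤ v := not_lt.1 fun h'' => h₂ ⟨h, h', h''⟩
      exact nested hs ht h.le h'' key hne

theorem isSimpleArc_segment {p q : EuclideanSpace ℝ (Fin 2)} (h : p ≠ q) :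
    IsSimpleArc (segment ℝ p q) p q := by
  refine ⟨⟨⟨fun t => AffineMap.lineMap p q (t : ℝ), by fun_prop⟩, by simp, by simp⟩, ?_, ?_⟩
  · intro x y hxy
    exact Subtype.ext (AffineMap.lineMap_injective ℝ h hxy)
  · rw [segment_eq_image_lineMap]
    ext z
    simp only [Set.mem_range, mem_image]
    exact ⟨fun ⟨t, ht⟩ => ⟨t, t.2, ht⟩, fun ⟨t, ht, h⟩ => ⟨⟨t, ht⟩, h⟩⟩

variable {V : Type*} {G : SimpleGraph V}

/-- The straight-line drawing with vertices on the parabola. -/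
noncomputable def parabolaEmbedding (p : V → ℝ) (hp : Function.Injective p)
    (hG : ∀ u v x y, G.Adj u v → G.Adj x y → ¬ (p u < p x ∧ p x < p v ∧ p v < p y)) :
    G.PlanarEmbedding where
  pt v := parabolaPoint (p v)
  pt_injective := parabolaPoint_injective.comp hp
  arc := Sym2.lift ⟨fun u v => segment ℝ (parabolaPoint (p u)) (parabolaPoint (p v)),
    fun _ _ => segment_symm ℝ _ _⟩
  isSimpleArc u v h := isSimpleArc_segment ((parabolaPoint_injective.comp hp).ne h.ne)
  mem_of_pt_mem e he v hv := by
    induction e with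
    | h a b =>
      rw [Sym2.lift_mk] at hv
      rw [Sym2.mem_iff]
      exact (parabolaPoint_mem_chord hv).imp (fun h => hp h) (fun h => hp h)
  arc_inter e he f hf hef := by
    have oriented : ∀ g ∈ G.edgeSet, ∃ a b, g = s(a, b) ∧ p a < p b ∧ G.Adj a b := by
      intro g hg
      induction g with
      | h a b =>
        rcases lt_or_gt_of_ne (hp.ne (G.ne_of_adj hg)) with h | h
        · exact ⟨a, b, rfl, h, hg⟩
        · exact ⟨b, a, Sym2.eq_swap, h, G.adj_symm hg⟩
    obtain ⟨a, b, rfl, hab, hadj⟩ := oriented e he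
    obtain ⟨c, d, rfl, hcd, hadj'⟩ := oriented f hf
    rintro z ⟨hz, hz'⟩
    rw [Sym2.lift_mk] at hz hz'
    obtain ⟨r, rfl, h1, h2⟩ := chord_inter_chord hab hcd (hG _ _ _ _ hadj hadj')
      (hG _ _ _ _ hadj' hadj) (fun h => hef (by rw [hp h.1, hp h.2])) hz hz'
    have : ∃ v, r = p v ∧ v ∈ s(a, b) := by
      rcases h1 with h1 | h1
      · exact ⟨a, h1, Sym2.mem_mk_left _ _⟩
      · exact ⟨b, h1, Sym2.mem_mk_right _ _⟩
    obtain ⟨v, rfl, hv⟩ := this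
    exact ⟨v, ⟨hv, Sym2.mem_iff.2 (h2.imp (fun h => hp h) (fun h => hp h))⟩, rfl⟩

/-- Chords lie on or above the parabola, so the region strictly below it misses the drawing. This
region is connected and unbounded, hence contained in an outer face, and every vertex is a limit of
its points. -/
theorem isOuterplanar_of_noncrossing (p : V → ℝ) (hp : Function.Injective p)
    (hG : ∀ u v x y, G.Adj u v → G.Adj x y → ¬ (p u < p x ∧ p x < p v ∧ p v < p y)) :
    G.IsOuterplanar := by
  let P := parabolaEmbedding p hp hG
  let φ : ℝ × ℝ → EuclideanSpace ℝ (Fin 2) := fun x => !₂[x.1, x.1 ^ 2 - x.2]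
  have hφ : Continuous φ := by
    refine (PiLp.continuous_toLp 2 _).comp (continuous_pi fun i => ?_)
    fin_cases i <;> simp <;> fun_prop
  let U := φ '' (univ ×ˢ Ioi 0)
  have hU : IsPreconnected U :=
    (isPreconnected_univ.prod isPreconnected_Ioi).image _ hφ.continuousOn
  have hUP : U ⊆ P.supportᶜ := by
    rintro _ ⟨⟨x, s⟩, ⟨-, hs⟩, rfl⟩ hmem
    have hs : 0 < s := hs
    rcases hmem with ⟨v, hv⟩ | hmem
    · have h0 : p v = x := congrArg (fun z : EuclideanSpace ℝ (Fin 2) => z 0) hv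
      have h1 : p v ^ 2 = x ^ 2 - s := congrArg (fun z : EuclideanSpace ℝ (Fin 2) => z 1) hv
      rw [h0] at h1
      linarith
    · simp only [mem_iUnion] at hmem
      obtain ⟨e, he, hmem⟩ := hmem
      induction e with
      | h a b =>
        have hmem : φ (x, s) ∈ segment ℝ (parabolaPoint (p a)) (parabolaPoint (p b)) := hmem
        obtain ⟨h1, h2⟩ := mem_chord hmem
        have e0 : φ (x, s) 0 = x := rfl
        have e1 : φ (x, s) 1 = x ^ 2 - s := rfl
        rw [e0] at h1 h2
        rw [e1] at h1
        nlinarith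
  have hmemU : ∀ x s : ℝ, 0 < s → φ (x, s) ∈ U := fun x s hs => ⟨(x, s), ⟨mem_univ _, hs⟩, rfl⟩
  have hUF : U ⊆ connectedComponentIn P.supportᶜ (φ (0, 1)) :=
    hU.subset_connectedComponentIn (hmemU 0 1 one_pos) hUP
  refine ⟨P, connectedComponentIn P.supportᶜ (φ (0, 1)),
    ⟨⟨φ (0, 1), hUP (hmemU 0 1 one_pos), rfl⟩, fun hb => ?_⟩, fun v => ⟨?_, ?_⟩⟩
  · obtain ⟨C, hC⟩ := (hb.subset hUF).exists_norm_le
    have h1 := hC _ (hmemU (|C| + 1) 1 one_pos)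
    have h2 := PiLp.norm_apply_le (φ (|C| + 1, 1)) 0
    have h3 : φ (|C| + 1, 1) 0 = |C| + 1 := rfl
    rw [h3, Real.norm_eq_abs] at h2
    have := le_abs_self (|C| + 1)
    have := le_abs_self C
    linarith
  · refine closure_mono hUF ?_
    have hlim : Filter.Tendsto (fun s : ℝ => φ (p v, s)) (𝓝[>] 0) (𝓝 (φ (p v, 0))) :=
      ((hφ.comp (by fun_prop : Continuous fun s : ℝ => (p v, s))).tendsto 0).mono_left
        nhdsWithin_le_nhds
    have h0 : φ (p v, 0) = P.pt v := by
      refine eq_parabolaPoint rfl ?_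
      change p v ^ 2 - 0 = p v ^ 2
      ring
    rw [h0] at hlim
    exact mem_closure_of_tendsto hlim (eventually_mem_nhdsWithin.mono fun s hs => hmemU _ _ hs)
  · intro hmem
    exact connectedComponentIn_subset _ _ (interior_subset hmem) (Or.inl ⟨v, rfl⟩)

/-! ### Convex drawings of universal outerplanar graphs -/

namespace OuteredgeGraph

/-- No vertex lies strictly between `u` and `v`, or all vertices lie between them. -/
def IsHullEdge {V : Type*} (p : V → ℝ) (u v : V) : Prop :=
  p u < p v ∧ ((∀ x, ¬ (p u < p x ∧ p x < p v)) ∨ ∀ x, p u ≤ p x ∧ p x ≤ p v)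

/-- `H` has a non-crossing drawing with vertices on a convex curve whose outeredges are on the
convex hull. -/
def IsConvexDrawable (H : OuteredgeGraph) : Prop :=
  ∃ p : H.V → ℝ, Function.Injective p ∧
    (∀ u v x y, H.graph.Adj u v → H.graph.Adj x y → ¬ (p u < p x ∧ p x < p v ∧ p v < p y)) ∧
    ∀ e ∈ H.outer, ∃ u v, e = s(u, v) ∧ IsHullEdge p u v

theorem mem_outer_triangle {e : Sym2 (Fin 3)} (he : e ∈ triangle.outer) :
    e = s(0, 1) ∨ e = s(1, 2) ∨ e = s(0, 2) := by
  have he : e ∈ ({s(0, 1), s(1, 2), s(0, 2)} : Finset (Sym2 (Fin 3))) := he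
  simpa using he

theorem isConvexDrawable_triangle : triangle.IsConvexDrawable := by
  refine ⟨fun i : Fin 3 => ((i : ℕ) : ℝ), fun a b h => Fin.ext (Nat.cast_injective h), ?_, ?_⟩
  · rintro (u : Fin 3) (v : Fin 3) (x : Fin 3) (y : Fin 3) - - ⟨h1, h2, h3⟩
    simp only [Nat.cast_lt] at h1 h2 h3
    omega
  · intro e he
    rcases mem_outer_triangle he with rfl | rfl | rfl
    · refine ⟨_, _, rfl, by simp, Or.inl ?_⟩
      rintro (x : Fin 3) ⟨h1, h2⟩
      simp only [Nat.cast_lt] at h1 h2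
      simp at h1 h2
      omega
    · refine ⟨_, _, rfl, by simp, Or.inl ?_⟩
      rintro (x : Fin 3) ⟨h1, h2⟩
      simp only [Nat.cast_lt] at h1 h2
      simp at h1 h2
      omega
    · refine ⟨_, _, rfl, by simp, Or.inr ?_⟩
      rintro (x : Fin 3)
      simp only [Nat.cast_le]
      simp
      omega

/-- The new vertex goes to the midpoint of the gap when the outeredge joins consecutive vertices,
and beyond the last vertex when it joins the first to the last. Either way, both new edges are again
hull edges, and hull edges cross nothing. -/
theorem IsConvexDrawable.addEars {H : OuteredgeGraph} (hH : H.IsConvexDrawable) :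
    H.addEars.IsConvexDrawable := by
  obtain ⟨p, hp, hcross, hout⟩ := hH
  have hm : ∀ e : {e : Sym2 H.V // e ∈ H.outer}, ∃ (u v : H.V) (m : ℝ), e.1 = s(u, v) ∧ p u < p v ∧
      (((∀ x, p x ≤ p u ∨ p v ≤ p x) ∧ p u < m ∧ m < p v) ∨
        ((∀ x, p u ≤ p x ∧ p x ≤ p v) ∧ m = p v + 1)) := by
    intro e
    obtain ⟨u, v, he, huv, h | h⟩ := hout e.1 e.2
    · refine ⟨u, v, (p u + p v) / 2, he, huv, Or.inl ⟨fun x => ?_, by linarith, by linarith⟩⟩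
      by_contra! hx
      exact h x hx
    · exact ⟨u, v, p v + 1, he, huv, Or.inr ⟨h, rfl⟩⟩
  choose lo hi m he hlt hcase using hm
  have hext : ∀ e f, p (lo e) = p (lo f) → p (hi e) = p (hi f) → e = f := fun e f h1 h2 =>
    Subtype.ext (by rw [he e, he f, hp h1, hp h2])
  -- inserted vertices are on the same side of everything else as the ends of their edge
  have hnew : ∀ e f, e ≠ f → (∀ x, p x ≤ p (lo e) ∨ p (hi e) ≤ p x) → m f ≤ p (lo e) ∨ p (hi e) ≤ m f := by
    intro e f hef h
    rcases hcase f with ⟨h1, h2, h3⟩ | ⟨h1, h2⟩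
    -- If `m f` fell into the vertex-free gap of `e` as well as into that of `f`, the gaps would
    -- have the same ends.
    · by_contra! hc
      have a1 := h (lo f)
      have a2 := h (hi f)
      have b1 := h1 (lo e)
      have b2 := h1 (hi e)
      have c1 := hlt e
      have c2 := hlt f
      refine hef (hext e f ?_ ?_) <;> rcases a1 with a1 | a1 <;> rcases a2 with a2 | a2 <;>
        rcases b1 with b1 | b1 <;> rcases b2 with b2 | b2 <;> linarith
    · right
      have := (h1 (hi e)).2
      linarith
  have hfull : ∀ e f, e ≠ f → (∀ x, p (lo e) ≤ p x ∧ p x ≤ p (hi e)) →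
      p (lo e) ≤ m f ∧ m f ≤ p (hi e) := by
    intro e f hef h
    rcases hcase f with ⟨h1, h2, h3⟩ | ⟨h1, h2⟩
    · exact ⟨(h (lo f)).1.trans h2.le, h3.le.trans (h (hi f)).2⟩
    · exact (hef (hext e f (le_antisymm (h _).1 (h1 _).1) (le_antisymm (h1 _).2 (h _).2))).elim
  let q : H.addEars.V → ℝ := Sum.elim p m
  have hlo : ∀ e, IsHullEdge (V := H.addEars.V) q (Sum.inl (lo e)) (Sum.inr e) ∨
      IsHullEdge (V := H.addEars.V) q (Sum.inr e) (Sum.inl (lo e)) := by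
    intro e
    left
    have c := hlt e
    rcases hcase e with ⟨h1, h2, h3⟩ | ⟨h1, h2⟩
    · refine ⟨h2, Or.inl ?_⟩
      rintro (x | f) ⟨hx1, hx2⟩
      · have hx1 : p (lo e) < p x := hx1
        have hx2 : p x < m e := hx2
        rcases h1 x with h | h <;> linarith
      · have hx1 : p (lo e) < m f := hx1
        have hx2 : m f < m e := hx2
        have hef : e ≠ f := by rintro rfl; exact lt_irrefl _ hx2
        rcases hnew e f hef h1 with h | h <;> linarith
    · refine ⟨show p (lo e) < m e by linarith, Or.inr ?_⟩
      rintro (x | f)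
      · change p (lo e) ≤ p x ∧ p x ≤ m e
        have := h1 x
        exact ⟨this.1, by linarith⟩
      · change p (lo e) ≤ m f ∧ m f ≤ m e
        rcases eq_or_ne e f with rfl | hef
        · exact ⟨by linarith, le_rfl⟩
        · have := hfull e f hef h1
          exact ⟨this.1, by linarith⟩
  have hhi : ∀ e, IsHullEdge (V := H.addEars.V) q (Sum.inl (hi e)) (Sum.inr e) ∨
      IsHullEdge (V := H.addEars.V) q (Sum.inr e) (Sum.inl (hi e)) := by
    intro e
    have c := hlt e
    rcases hcase e with ⟨h1, h2, h3⟩ | ⟨h1, h2⟩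
    · refine Or.inr ⟨h3, Or.inl ?_⟩
      rintro (x | f) ⟨hx1, hx2⟩
      · have hx1 : m e < p x := hx1
        have hx2 : p x < p (hi e) := hx2
        rcases h1 x with h | h <;> linarith
      · have hx1 : m e < m f := hx1
        have hx2 : m f < p (hi e) := hx2
        have hef : e ≠ f := by rintro rfl; exact lt_irrefl _ hx1
        rcases hnew e f hef h1 with h | h <;> linarith
    · refine Or.inl ⟨show p (hi e) < m e by linarith, Or.inl ?_⟩
      rintro (x | f) ⟨hx1, hx2⟩
      · have hx1 : p (hi e) < p x := hx1
        have := h1 x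
        linarith
      · have hx1 : p (hi e) < m f := hx1
        have hx2 : m f < m e := hx2
        have hef : e ≠ f := by rintro rfl; exact lt_irrefl _ hx2
        have := hfull e f hef h1
        linarith
  have hear : ∀ (v : H.V) e, v ∈ e.1 →
      IsHullEdge (V := H.addEars.V) q (Sum.inl v) (Sum.inr e) ∨
      IsHullEdge (V := H.addEars.V) q (Sum.inr e) (Sum.inl v) := by
    intro v e hv
    rw [he e, Sym2.mem_iff] at hv
    rcases hv with rfl | rfl
    · exact hlo e
    · exact hhi e
  have hadj : ∀ x y, H.addEars.graph.Adj x y →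
      (∃ u v, x = Sum.inl u ∧ y = Sum.inl v ∧ H.graph.Adj u v) ∨ IsHullEdge q x y ∨
        IsHullEdge q y x := by
    rintro (u | e) (v | f) h
    · exact Or.inl ⟨u, v, rfl, rfl, h⟩
    · exact Or.inr (hear u f h)
    · exact Or.inr (hear v e h).symm
    · exact h.elim
  refine ⟨q, ?_, ?_, ?_⟩
  · have hpm : ∀ x e, p x ≠ m e := by
      intro x e h
      rcases hcase e with ⟨h1, h2, h3⟩ | ⟨h1, h2⟩
      · rcases h1 x with h' | h' <;> linarith
      · have := h1 x
        linarith
    rintro (x | e) (y | f) h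
    · exact congrArg _ (hp h)
    · exact (hpm _ _ h).elim
    · exact (hpm _ _ h.symm).elim
    · congr 1
      by_contra hef
      have h : m e = m f := h
      rcases hcase e with ⟨h1, h2, h3⟩ | ⟨h1, h2⟩
      · rcases hnew e f hef h1 with h' | h' <;> linarith
      · have := hfull e f hef h1
        linarith
  · rintro u v x y huv hxy ⟨h1, h2, h3⟩
    rcases hadj u v huv with ⟨a, b, rfl, rfl, hab⟩ | h | h
    · rcases hadj x y hxy with ⟨c, d, rfl, rfl, hcd⟩ | h | h
      · exact hcross a b c d hab hcd ⟨h1, h2, h3⟩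
      · rcases h.2 with h | h
        · exact h _ ⟨h2, h3⟩
        · exact (h (Sum.inl a)).1.not_gt h1
      · have := h.1
        linarith
    · rcases h.2 with h | h
      · exact h _ ⟨h1, h2⟩
      · exact (h y).2.not_gt h3
    · have := h.1
      linarith
  · intro e' he'
    obtain ⟨⟨v, e⟩, hve, rfl⟩ := Finset.mem_image.1 he'
    rcases hear v e (by simpa using hve) with h | h
    · exact ⟨_, _, rfl, h⟩
    · exact ⟨_, _, Sym2.eq_swap, h⟩

end OuteredgeGraph

theorem UOP_isConvexDrawable : ∀ n, (UOP n).IsConvexDrawable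
  | 0 => OuteredgeGraph.isConvexDrawable_triangle
  | 1 => OuteredgeGraph.isConvexDrawable_triangle
  | n + 2 => (UOP_isConvexDrawable (n + 1)).addEars

theorem UOP_isOuterplanar (n : ℕ) : (UOP n).graph.IsOuterplanar := by
  obtain ⟨p, hp, h, -⟩ := UOP_isConvexDrawable n
  exact isOuterplanar_of_noncrossing p hp h

end SimpleGraph

/-! ### The lower bound for the universal outerplanar graph -/

namespace SimpleGraph

namespace OuteredgeGraph

open Classical in
/-- The sum over all vertices of the in-degree minus two. -/
noncomputable def excess (H : OuteredgeGraph) (D : H.V → H.V → Prop) : ℤ :=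
  ∑ v, ((((Finset.univ.filter fun u => D u v).card : ℕ) : ℤ) - 2)

/-- All outeredges are edges. -/
def OuterSubset (H : OuteredgeGraph) : Prop := ∀ e ∈ H.outer, e ∈ H.graph.edgeSet

theorem outerSubset_triangle : triangle.OuterSubset := by
  intro e he
  have h : ∀ a b : Fin 3, a ≠ b → s(a, b) ∈ triangle.graph.edgeSet := fun a b hab => hab
  rcases mem_outer_triangle he with rfl | rfl | rfl <;> exact h _ _ (by decide)

theorem outerSubset_addEars (H : OuteredgeGraph) : H.addEars.OuterSubset := by
  intro e' he'
  obtain ⟨⟨v, e⟩, hve, rfl⟩ := Finset.mem_image.1 he'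
  have : v ∈ e.1 := by simpa using hve
  exact this

variable {H : OuteredgeGraph}

theorem card_filter_mem (hH : H.OuterSubset) {e : Sym2 H.V} (he : e ∈ H.outer) :
    (Finset.univ.filter fun v => v ∈ e).card = 2 := by
  have hd : ¬ e.IsDiag := H.graph.not_isDiag_of_mem_edgeSet (hH e he)
  rw [← Sym2.card_toFinset_of_not_isDiag e hd]
  congr 1
  ext v
  simp

/-- An ear has degree 2, so its in-degree minus two is minus its number of outgoing arcs, and
exactly these arcs are added to the in-degrees of old vertices. -/
theorem excess_addEars (hH : H.OuterSubset) {D : H.addEars.V → H.addEars.V → Prop}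
    (hD : ∀ u v, D u v → H.addEars.graph.Adj u v)
    (hD' : ∀ u v, H.addEars.graph.Adj u v → Xor (D u v) (D v u)) :
    H.addEars.excess D = H.excess fun u v => D (Sum.inl u) (Sum.inl v) := by
  classical
  let E := {e : Sym2 H.V // e ∈ H.outer}
  have card_sum : ∀ Q : H.V ⊕ E → Prop, ((Finset.univ.filter Q).card : ℤ) =
      (Finset.univ.filter fun u => Q (Sum.inl u)).card +
        (Finset.univ.filter fun e => Q (Sum.inr e)).card := by
    intro Q
    simp only [Finset.card_filter, Fintype.sum_sum_type]
    push_cast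
    rfl
  have hee : ∀ e f : E, ¬ D (Sum.inr e) (Sum.inr f) := fun e f h => hD _ _ h
  have hear : ∀ e : E, ((Finset.univ.filter fun v => D (Sum.inr e) (Sum.inl v)).card : ℤ) +
      (Finset.univ.filter fun v => D (Sum.inl v) (Sum.inr e)).card = 2 := by
    intro e
    rw [← Nat.cast_add, ← Finset.card_union_of_disjoint]
    · have := card_filter_mem hH e.2
      rw [show (2 : ℤ) = ((2 : ℕ) : ℤ) from rfl, ← this]
      congr 2
      ext v
      simp only [Finset.mem_union, Finset.mem_filter, Finset.mem_univ, true_and]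
      constructor
      · rintro (h | h)
        · exact hD _ _ h
        · exact hD _ _ h
      · intro h
        rcases hD' (Sum.inl v) (Sum.inr e) h with h | h
        · exact Or.inr h.1
        · exact Or.inl h.1
    · rw [Finset.disjoint_filter]
      intro v _ h h'
      rcases hD' _ _ (hD _ _ h) with h'' | h''
      · exact h''.2 h'
      · exact h''.2 h
  have swap : ∑ v : H.V, ((Finset.univ.filter fun e : E => D (Sum.inr e) (Sum.inl v)).card : ℤ) =
      ∑ e : E, ((Finset.univ.filter fun v => D (Sum.inr e) (Sum.inl v)).card : ℤ) := by
    simp only [Finset.card_filter]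
    push_cast
    exact Finset.sum_comm
  have expand : H.addEars.excess D =
      ∑ v : H.V, (((Finset.univ.filter fun u : H.V ⊕ E => D u (Sum.inl v)).card : ℤ) - 2) +
      ∑ e : E, (((Finset.univ.filter fun u : H.V ⊕ E => D u (Sum.inr e)).card : ℤ) - 2) := by
    unfold excess
    exact Fintype.sum_sum_type _
  have hzero : ∀ f : E, (Finset.univ.filter fun e : E => D (Sum.inr e) (Sum.inr f)).card = 0 := by
    intro f
    simp [hee]
  rw [expand]
  simp only [card_sum, hzero, Nat.cast_zero, add_zero]
  have h1 : ∀ e : E, ((Finset.univ.filter fun v => D (Sum.inl v) (Sum.inr e)).card : ℤ) - 2 =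
      - ((Finset.univ.filter fun v => D (Sum.inr e) (Sum.inl v)).card : ℤ) := by
    intro e
    linarith [hear e]
  simp only [h1, Finset.sum_neg_distrib, ← swap, excess]
  rw [← sub_eq_add_neg, ← Finset.sum_sub_distrib]
  refine Finset.sum_congr rfl fun v _ => ?_
  ring

theorem excess_triangle {D : Fin 3 → Fin 3 → Prop}
    (hD : ∀ u v, D u v → u ≠ v) (hD' : ∀ u v, u ≠ v → Xor (D u v) (D v u)) :
    triangle.excess D = -3 := by
  classical
  have h01 := hD' 0 1 (by decide)
  have h02 := hD' 0 2 (by decide)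
  have h12 := hD' 1 2 (by decide)
  have hd : ∀ v, ¬ D v v := fun v h => hD v v h rfl
  have : triangle.excess D =
      ∑ v : Fin 3, ((((Finset.univ.filter fun u => D u v).card : ℕ) : ℤ) - 2) := by
    unfold excess
    exact Finset.sum_congr rfl fun v _ => by congr 3
  rw [this]
  simp only [Finset.card_filter, Fin.sum_univ_three, hd, if_false]
  rcases h01 with ⟨a, a'⟩ | ⟨a, a'⟩ <;> rcases h02 with ⟨b, b'⟩ | ⟨b, b'⟩ <;>
    rcases h12 with ⟨c, c'⟩ | ⟨c, c'⟩ <;> simp [a, a', b, b', c, c']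

/-- A bound for the total of in-weight minus two over a graph with outeredges, where the
contribution of the ears still to be added is estimated by `M`. -/
noncomputable def potential (H : OuteredgeGraph) (f : H.V → Fin 4) (M : Sym2 (Fin 4) → ℤ) : ℤ :=
  ∑ v, (((f v : ℕ) : ℤ) - 2) + ∑ e ∈ H.outer, M (e.map f)

theorem sum_outer_addEars (F : Sym2 H.addEars.V → ℤ) :
    ∑ e ∈ H.addEars.outer, F e = ∑ e : {e : Sym2 H.V // e ∈ H.outer},
      ∑ v with v ∈ e.1, F s(Sum.inl v, Sum.inr e) := by
  have : ∑ e ∈ H.addEars.outer, F e =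
      ∑ q : H.V × {e : Sym2 H.V // e ∈ H.outer} with q.1 ∈ q.2.1,
        F s(Sum.inl q.1, Sum.inr q.2) := by
    refine Finset.sum_image ?_
    rintro ⟨v, e⟩ - ⟨w, f⟩ - h
    rcases Sym2.eq_iff.1 h with ⟨h1, h2⟩ | ⟨h1, -⟩
    · exact Prod.ext (Sum.inl.inj h1) (Sum.inr.inj h2)
    · exact (Sum.inl_ne_inr h1).elim
  rw [this, Finset.sum_filter, Fintype.sum_prod_type, Finset.sum_comm]
  exact Finset.sum_congr rfl fun e _ => (Finset.sum_filter _ _).symm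

theorem sum_mem_pair {V : Type*} [Fintype V] [DecidableEq V] {a b : V} (hab : a ≠ b) (F : V → ℤ) :
    ∑ v with v ∈ s(a, b), F v = F a + F b := by
  rw [← Finset.sum_pair hab]
  congr 1
  ext v
  simp

/-- Each ear forms a triangle with its outeredge, and `f` is proper; hence a bound over triples of
distinct colours suffices. -/
theorem sum_ears_le (hH : H.OuterSubset) {f : H.addEars.V → Fin 4}
    (hf : ∀ u v, H.addEars.graph.Adj u v → f u ≠ f v) {M : Sym2 (Fin 4) → ℤ}
    {c : Fin 4 → Fin 4 → Fin 4 → ℤ}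
    (hM : ∀ a b x, a ≠ b → a ≠ x → b ≠ x → c a b x ≤ M s(a, b))
    (g : {e : Sym2 H.V // e ∈ H.outer} → ℤ)
    (hg : ∀ e a b, a ≠ b → e.1 = s(a, b) → g e ≤ c (f (Sum.inl a)) (f (Sum.inl b)) (f (Sum.inr e))) :
    ∑ e, g e ≤ ∑ e ∈ H.outer, M (e.map (f ∘ Sum.inl)) := by
  rw [← Finset.sum_coe_sort H.outer]
  refine Finset.sum_le_sum fun e _ => ?_
  obtain ⟨a, b, hab⟩ : ∃ a b, e.1 = s(a, b) := by
    induction he : e.1 with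
    | h a b => exact ⟨a, b, rfl⟩
  have hadj : H.graph.Adj a b := by
    have := hH e.1 e.2
    rwa [hab] at this
  refine (hg e a b hadj.ne hab).trans ?_
  rw [hab, Sym2.map_mk]
  refine hM _ _ _ (hf _ _ hadj) (hf _ _ ?_) (hf _ _ ?_)
  · change a ∈ e.1
    rw [hab]
    exact Sym2.mem_mk_left _ _
  · change b ∈ e.1
    rw [hab]
    exact Sym2.mem_mk_right _ _

/-- One step of the dynamic programme: an ear of colour `x` over an edge coloured `a`, `b`
contributes `x - 2` and replaces that outeredge by two, coloured `a`, `x` and `b`, `x`. -/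
theorem potential_addEars_le (hH : H.OuterSubset) {f : H.addEars.V → Fin 4}
    (hf : ∀ u v, H.addEars.graph.Adj u v → f u ≠ f v) {M N : Sym2 (Fin 4) → ℤ}
    (hMN : ∀ a b x : Fin 4, a ≠ b → a ≠ x → b ≠ x →
      (((x : ℕ) : ℤ) - 2) + (M s(a, x) + M s(b, x)) ≤ N s(a, b)) :
    H.addEars.potential f M ≤ H.potential (f ∘ Sum.inl) N := by
  have expand : ∑ v : H.addEars.V, (((f v : ℕ) : ℤ) - 2) = ∑ v, (((f (Sum.inl v) : ℕ) : ℤ) - 2) +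
      ∑ e : {e : Sym2 H.V // e ∈ H.outer}, (((f (Sum.inr e) : ℕ) : ℤ) - 2) :=
    Fintype.sum_sum_type _
  unfold potential
  rw [expand, sum_outer_addEars, add_assoc, ← Finset.sum_add_distrib]
  refine (add_le_add_iff_left _).2 (sum_ears_le hH hf hMN _ ?_)
  rintro e a b hab he
  rw [he, sum_mem_pair hab]
  rfl

/-- The start of the dynamic programme. Vertices of the last round have only two neighbours, so
their in-degree is at most the minimum of 2 and their colour; elsewhere the colour is the bound. -/
theorem excess_le_potential (hH : H.OuterSubset) {f : H.addEars.V → Fin 4}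
    (hf : ∀ u v, H.addEars.graph.Adj u v → f u ≠ f v) {D : H.addEars.V → H.addEars.V → Prop}
    (hD : ∀ u v, D u v → H.addEars.graph.Adj u v) {M : Sym2 (Fin 4) → ℤ}
    (hM : ∀ a b x : Fin 4, a ≠ b → a ≠ x → b ≠ x → min ((x : ℕ) : ℤ) 2 - 2 ≤ M s(a, b))
    (hle : ∀ v, Nat.card {u // D u v} ≤ (f v : ℕ)) :
    H.addEars.excess D ≤ H.potential (f ∘ Sum.inl) M := by
  classical
  have hle' : ∀ v, (Finset.univ.filter fun u => D u v).card ≤ (f v : ℕ) := by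
    intro v
    have := hle v
    rwa [Nat.card_eq_fintype_card, Fintype.card_subtype] at this
  have expand : H.addEars.excess D =
      ∑ v : H.V, (((Finset.univ.filter fun u => D u (Sum.inl v)).card : ℤ) - 2) +
      ∑ e : {e : Sym2 H.V // e ∈ H.outer},
        (((Finset.univ.filter fun u => D u (Sum.inr e)).card : ℤ) - 2) := by
    unfold excess
    exact Fintype.sum_sum_type _
  rw [expand]
  refine add_le_add (Finset.sum_le_sum fun v _ => ?_) (sum_ears_le hH hf hM _ ?_)
  · have := hle' (Sum.inl v)
    change _ ≤ ((f (Sum.inl v) : ℕ) : ℤ) - 2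
    omega
  · intro e a b hab he
    have h1 := hle' (Sum.inr e)
    have h2 : (Finset.univ.filter fun u => D u (Sum.inr e)).card ≤ 2 := by
      refine (Finset.card_le_card (t := {Sum.inl a, Sum.inl b}) ?_).trans Finset.card_le_two
      rintro (u | e') hu
      · have : u ∈ e.1 := hD _ _ (Finset.mem_filter.1 hu).2
        rw [he, Sym2.mem_iff] at this
        simpa using this
      · exact (hD _ _ (Finset.mem_filter.1 hu).2).elim
    omega

end OuteredgeGraph

/-- The function on unordered pairs given by a symmetric table. -/
def tableSym2 (M : Fin 4 → Fin 4 → ℤ) (hM : ∀ a b, M a b = M b a) : Sym2 (Fin 4) → ℤ :=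
  Sym2.lift ⟨M, hM⟩

/-- An upper bound for the contribution of a single ear. -/
def earBound₁ : Sym2 (Fin 4) → ℤ :=
  tableSym2 ![![0, 0, 0, 0], ![0, 0, 0, 0], ![0, 0, 0, -1], ![0, 0, -1, 0]] (by decide)

/-- An upper bound for the contribution of two rounds of ears at an outeredge. -/
def earBound₂ : Sym2 (Fin 4) → ℤ :=
  tableSym2 ![![0, 1, 0, -1], ![1, 0, 0, -1], ![0, 0, 0, -1], ![-1, -1, -1, 0]] (by decide)

/-- An upper bound for the contribution of three rounds of ears at an outeredge. -/
def earBound₃ : Sym2 (Fin 4) → ℤ :=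
  tableSym2 ![![0, 0, 0, -1], ![0, 0, -1, -1], ![0, -1, 0, -2], ![-1, -1, -2, 0]] (by decide)

theorem le_earBound₁ : ∀ a b x : Fin 4, a ≠ b → a ≠ x → b ≠ x →
    min ((x : ℕ) : ℤ) 2 - 2 ≤ earBound₁ s(a, b) := by
  simp only [earBound₁, tableSym2, Sym2.lift_mk]
  decide

/-- The off-diagonal entries of each table are the maxima of these left-hand sides over admissible
`x`; diagonal entries are never evaluated, as the ends of an edge have distinct colours. -/
theorem le_earBound₂ : ∀ a b x : Fin 4, a ≠ b → a ≠ x → b ≠ x →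
    (((x : ℕ) : ℤ) - 2) + (earBound₁ s(a, x) + earBound₁ s(b, x)) ≤ earBound₂ s(a, b) := by
  simp only [earBound₁, earBound₂, tableSym2, Sym2.lift_mk]
  decide

theorem le_earBound₃ : ∀ a b x : Fin 4, a ≠ b → a ≠ x → b ≠ x →
    (((x : ℕ) : ℤ) - 2) + (earBound₂ s(a, x) + earBound₂ s(b, x)) ≤ earBound₃ s(a, b) := by
  simp only [earBound₂, earBound₃, tableSym2, Sym2.lift_mk]
  decide

theorem triangle_potential_le {f : Fin 3 → Fin 4} (hf : Function.Injective f) :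
    OuteredgeGraph.triangle.potential f earBound₃ ≤ -4 := by
  have key : ∀ a b c : Fin 4, a ≠ b → b ≠ c → a ≠ c →
      (((a : ℕ) : ℤ) - 2) + (((b : ℕ) : ℤ) - 2) + (((c : ℕ) : ℤ) - 2) +
        (earBound₃ s(a, b) + (earBound₃ s(b, c) + earBound₃ s(a, c))) ≤ -4 := by
    simp only [earBound₃, tableSym2, Sym2.lift_mk]
    decide
  have expand : OuteredgeGraph.triangle.potential f earBound₃ =
      ∑ v : Fin 3, (((f v : ℕ) : ℤ) - 2) +
        ∑ e ∈ ({s(0, 1), s(1, 2), s(0, 2)} : Finset (Sym2 (Fin 3))), earBound₃ (e.map f) := rfl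
  rw [expand, Fin.sum_univ_three, Finset.sum_insert (by decide), Finset.sum_insert (by decide),
    Finset.sum_singleton]
  exact key _ _ _ (hf.ne (by decide)) (hf.ne (by decide)) (hf.ne (by decide))

theorem four_le_semiProperOrientationNumber_UOP :
    4 ≤ (UOP 4).graph.semiProperOrientationNumber := by
  classical
  refine le_iInf fun O => ?_
  by_contra! hlt
  have hlt : O.maxInWeight < 4 := by exact_mod_cast hlt
  have hw : ∀ v, inWeight O.D O.weight v < 4 := fun v =>
    (Finset.le_sup (f := inWeight O.D O.weight) (Finset.mem_univ v)).trans_lt hlt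
  let T₁ := OuteredgeGraph.triangle
  let T₂ := T₁.addEars
  let T₃ := T₂.addEars
  let T₄ := T₃.addEars
  let f : T₄.V → Fin 4 := fun v => ⟨inWeight O.D O.weight v, hw v⟩
  have hf : ∀ u v, T₄.graph.Adj u v → f u ≠ f v := fun u v h e =>
    O.proper u v h (congrArg Fin.val e)
  let D : T₄.V → T₄.V → Prop := O.D.Adj
  have hD : ∀ u v, D u v → T₄.graph.Adj u v := O.isOrientation.1
  have hD' : ∀ u v, T₄.graph.Adj u v → Xor (D u v) (D v u) := O.isOrientation.2
  -- Weights are positive integers, so in-degrees are at most in-weights.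
  have hle : ∀ v, Nat.card {u // D u v} ≤ (f v : ℕ) := by
    intro v
    rw [Nat.card_eq_fintype_card, Fintype.card_subtype, Finset.card_eq_sum_ones]
    refine (Finset.sum_le_sum (g := fun u => O.weight u v) fun u hu =>
      O.weight_pos u v (Finset.mem_filter.1 hu).2).trans (le_of_eq ?_)
    change _ = inWeight O.D O.weight v
    unfold inWeight
    congr
  have s₁ : T₁.OuterSubset := OuteredgeGraph.outerSubset_triangle
  have s₂ : T₂.OuterSubset := OuteredgeGraph.outerSubset_addEars _
  have s₃ : T₃.OuterSubset := OuteredgeGraph.outerSubset_addEars _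
  have e₄ : T₄.excess D = -3 := by
    rw [OuteredgeGraph.excess_addEars s₃ hD hD',
      OuteredgeGraph.excess_addEars s₂ (D := fun u v => D (Sum.inl u) (Sum.inl v))
        (fun u v => hD (Sum.inl u) (Sum.inl v)) (fun u v => hD' (Sum.inl u) (Sum.inl v)),
      OuteredgeGraph.excess_addEars s₁
        (D := fun u v => D (Sum.inl (Sum.inl u)) (Sum.inl (Sum.inl v)))
        (fun u v => hD (Sum.inl (Sum.inl u)) (Sum.inl (Sum.inl v)))
        (fun u v => hD' (Sum.inl (Sum.inl u)) (Sum.inl (Sum.inl v)))]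
    exact OuteredgeGraph.excess_triangle
      (fun u v => hD (Sum.inl (Sum.inl (Sum.inl u))) (Sum.inl (Sum.inl (Sum.inl v))))
      (fun u v => hD' (Sum.inl (Sum.inl (Sum.inl u))) (Sum.inl (Sum.inl (Sum.inl v))))
  have p₃ := OuteredgeGraph.excess_le_potential s₃ hf hD le_earBound₁ hle
  have p₂ := OuteredgeGraph.potential_addEars_le s₂ (f := f ∘ Sum.inl)
    (fun u v => hf (Sum.inl u) (Sum.inl v))
    le_earBound₂
  have p₁ := OuteredgeGraph.potential_addEars_le s₁ (f := (f ∘ Sum.inl) ∘ Sum.inl)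
    (fun u v => hf (Sum.inl (Sum.inl u)) (Sum.inl (Sum.inl v))) le_earBound₃
  have p₀ := triangle_potential_le (f := ((f ∘ Sum.inl) ∘ Sum.inl) ∘ Sum.inl) (by
    intro a b hab
    by_contra hne
    exact hf (Sum.inl (Sum.inl (Sum.inl a))) (Sum.inl (Sum.inl (Sum.inl b))) hne hab)
  -- The chain of estimates reads -3 ≤ -4.
  have := e₄ ▸ p₃.trans (p₂.trans (p₁.trans p₀))
  norm_num at this

end SimpleGraph

theorem theorem3 :
    (∀ {V : Type*} [Fintype V] (G : SimpleGraph V),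
      G.IsOuterplanar → G.semiProperOrientationNumber ≤ 4) ∧
    (SimpleGraph.UOP 4).graph.IsOuterplanar ∧
    (SimpleGraph.UOP 4).graph.semiProperOrientationNumber = 4 :=
  ⟨fun _ hG => hG.semiProperOrientationNumber_le, SimpleGraph.UOP_isOuterplanar 4,
    le_antisymm (SimpleGraph.UOP_isOuterplanar 4).semiProperOrientationNumber_le
      SimpleGraph.four_le_semiProperOrientationNumber_UOP⟩
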